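/- Let $K$ be an algebraically closed field. For $n\ge 1$ let $T_n$ be the space of upper triangular $n\times n$ matrices over $K$, and let $$CT_n=\{(X,Y)\in T_n\times T_n : XY=YX\},$$ regarded as a closed subset of the affine space $T_n\times T_n\cong\mathbb A_K^{n(n+1)}$. Let $NT_n\subseteq CT_n$ be the set of pairs in which both matrices are strictly upper triangular, and let $CT_n^0$ be the Zariski closure of the set of those $(X,Y)\in CT_n$ for which both $X$ and $Y$ have minimal polynomial of degree $n$. For a partition $J$ of $\{1,\dots,n\}$ into intervals of consecutive integers, let $NT_n^J$ be the set of $(X,Y)\in NT_n$ such that the $(i,j)$ entries of $X$ and of $Y$ are zero whenever $i,j$ lie in the same block of $J$. The additive group $K^2$ acts on $CT_n$ by $(x,y)\cdot(X,Y)=(X+xI_n,\,Y+yI_n)$. A closed subset $V\subseteq\mathbb A_K^N$ is called a complete intersection if it is the set of common zeros of $N-\dim V$ polynomials. Let $J$ be the partition of $\{1,\dots,18\}$ into consecutive intervals of sizes $1,5,6,5,1$ (in this order). Then: 1. $\dim NT_{18}^J\ge 188$. 2. The orbit $K^2\cdot NT_{18}^J$ has dimension at least $190$. 3. $\dim CT_{18}^0=189$.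 4. $CT_{18}$ is not a complete intersection. In particular, the ideal of all polynomials vanishing on $CT_{18}$ cannot be generated by $\operatorname{codim} CT_{18}$ elements. 5. There is a natural number $m<18$ such that, for every $n\ge 1$, $CT_n$ is not a complete intersection if and only if $n>m$. -/

import Mathlib

namespace CommTri

noncomputable section

/-! ### Dimension, Zariski closure and complete intersections in affine space -/

section Affine

variable {K : Type*} [Field K] {σ : Type*}

/-- The dimension of a subset `V` of the affine space `σ → K`: the Krull dimension of its
coordinate ring, that is, of the polynomial ring modulo the polynomials vanishing on `V`. -/
def dim (V : Set (σ → K)) : WithBot ℕ∞ :=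
  ringKrullDim (MvPolynomial σ K ⧸ MvPolynomial.vanishingIdeal K V)

/-- The Zariski closure of a subset of the affine space `σ → K`. -/
def zariskiClosure (S : Set (σ → K)) : Set (σ → K) :=
  MvPolynomial.zeroLocus K (MvPolynomial.vanishingIdeal K S)

/-- `V` is a complete intersection in `σ → K`: for `c` the codimension of `V`, it is the set of
common zeros of `c` polynomials. This does not ask that these polynomials generate a radical
ideal, so it is the weakest notion, and its negation is the strongest statement. -/
def IsCompleteIntersection [Fintype σ] (V : Set (σ → K)) : Prop :=
  ∃ (c : ℕ) (f : Fin c → MvPolynomial σ K),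
    V = {v | ∀ i, MvPolynomial.eval v (f i) = 0} ∧
      dim V + (c : WithBot ℕ∞) = (Fintype.card σ : WithBot ℕ∞)

/-- `V` is an ideal-theoretic complete intersection in `σ → K`: for `c` the codimension of `V`,
the ideal of all polynomials vanishing on `V` is generated by `c` elements. -/
def IsIdealCompleteIntersection [Fintype σ] (V : Set (σ → K)) : Prop :=
  ∃ (c : ℕ) (f : Fin c → MvPolynomial σ K),
    MvPolynomial.vanishingIdeal K V = Ideal.span (Set.range f) ∧
      dim V + (c : WithBot ℕ∞) = (Fintype.card σ : WithBot ℕ∞)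

end Affine

/-! ### Pairs of upper triangular matrices -/

/-- The positions `(i, j)`, `i ≤ j`, of the entries of an upper triangular matrix. -/
abbrev UpperIdx (n : ℕ) : Type := {p : Fin n × Fin n // p.1 ≤ p.2}

/-- The coordinates on `T_n × T_n`. A point `(X, Y)` of `T_n × T_n` is a function
`PairIdx n → K`: the left summand holds the entries of `X`, the right one those of `Y`. -/
abbrev PairIdx (n : ℕ) : Type := UpperIdx n ⊕ UpperIdx n

section Matrices

variable (K : Type*) [Field K] (n : ℕ)

variable {K n} in
/-- The upper triangular matrix with the given entries on and above the diagonal. -/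
def upperMatrix (x : UpperIdx n → K) : Matrix (Fin n) (Fin n) K :=
  Matrix.of fun i j => if h : i ≤ j then x ⟨(i, j), h⟩ else 0

variable {K n} in
/-- The matrix `X` of the point `v = (X, Y)` of `T_n × T_n`. -/
def matX (v : PairIdx n → K) : Matrix (Fin n) (Fin n) K :=
  upperMatrix fun p => v (Sum.inl p)

variable {K n} in
/-- The matrix `Y` of the point `v = (X, Y)` of `T_n × T_n`. -/
def matY (v : PairIdx n → K) : Matrix (Fin n) (Fin n) K :=
  upperMatrix fun p => v (Sum.inr p)

/-- `CT_n`: the pairs of commuting upper triangular `n × n` matrices. -/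
def CT : Set (PairIdx n → K) :=
  {v | matX v * matY v = matY v * matX v}

/-- `NT_n`: the pairs of commuting strictly upper triangular `n × n` matrices. -/
def NT : Set (PairIdx n → K) :=
  {v | v ∈ CT K n ∧ ∀ i, matX v i i = 0 ∧ matY v i i = 0}

variable {K n} in
/-- A matrix is regular if its minimal polynomial has degree `n`. -/
def IsRegularMatrix (A : Matrix (Fin n) (Fin n) K) : Prop :=
  (minpoly K A).natDegree = n

/-- `CT_n^0`: the Zariski closure of the set of the pairs of regular matrices in `CT_n`. -/
def CTzero : Set (PairIdx n → K) :=
  zariskiClosure {v | v ∈ CT K n ∧ IsRegularMatrix (matX v) ∧ IsRegularMatrix (matY v)}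

variable {n} in
/-- `NT_n^J`, for `J` a partition of the index set into consecutive intervals (encoded by the
composition of `n` listing their lengths from left to right): the pairs in `NT_n` whose entries
`(i, j)` are zero whenever `i` and `j` lie in the same block of `J`. -/
def NTblock (J : Composition n) : Set (PairIdx n → K) :=
  {v | v ∈ NT K n ∧ ∀ i j, J.index i = J.index j → matX v i j = 0 ∧ matY v i j = 0}

variable {K n} in
/-- The orbit of a set of pairs under the action `(x, y) • (X, Y) = (X + x I, Y + y I)` of `K²`. -/
def scalarOrbit (S : Set (PairIdx n → K)) : Set (PairIdx n → K) :=
  {v | ∃ w ∈ S, ∃ x y : K,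
    matX v = matX w + x • (1 : Matrix (Fin n) (Fin n) K) ∧
    matY v = matY w + y • (1 : Matrix (Fin n) (Fin n) K)}

end Matrices

end

end CommTri

/-!
The dimension of a closed set is measured on prime ideals: by Krull's height theorem, a component
of the zero set of `c` polynomials through a common zero has codimension at most `c`
(`exists_isPrime_card_le_of_common_zero`), while a domain has dimension at most its transcendence
degree (`ringKrullDim_le_of_trdeg_le`), because each step of a chain of primes supplies a further
algebraically independent element.

The set `CT_n` is defined by the `n (n - 1) / 2` entries of the commutator above the diagonal, so
each of its components has dimension at least `n (n + 3) / 2`. Where the first matrix has distinct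
diagonal entries, the second is determined up to algebraic functions by its own diagonal
(`isAlgebraic_entry_of_commute`), so a component through such a point has exactly this dimension.
All components of a complete intersection have the same dimension; hence `CT_n` is a complete
intersection if and only if `dim CT_n = n (n + 3) / 2` (`isCompleteIntersection_CT_iff`).

Passing from `n` to `n + 1` adds `2 n + 2` coordinates, the last columns, and `n` equations without
constant term in these. So `dim CT_{n+1} ≥ dim CT_n + n + 2` (`dim_CT_add_le_dim_CT_succ`), and
failure of the complete intersection property is inherited by all larger sizes.

For blocks of sizes `1, 5, 6, 5, 1` there are `118` positions above the block diagonal, and `48` of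
them are at least two blocks away from it. Only there can the commutator of two strictly block
upper triangular matrices be nonzero, and the zero pair solves the equations, so the dimension is
at least `2 * 118 - 48 = 188`. Scalar matrices contribute two more dimensions, and `190` exceeds
the value `18 * 21 / 2 = 189` required of a complete intersection.

For `CT_n^0`, a matrix commuting with a regular matrix `X` is a polynomial in `X`, which bounds the
dimension above by that of the space of pairs `(X, c)` of a triangular matrix and the coefficients
of a polynomial of degree less than `n` (`dim_CTzero_le`). The lower bound comes from the component
of `CT_n` through a pair of diagonal matrices with distinct entries, where the pairs of regular
matrices are dense (`card_upperIdx_add_le_dim_CTzero`).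

The number `n (n + 3) / 2` appears as `Fintype.card (UpperIdx n) + n`.
-/

namespace CommTri

/-! ### Krull dimension, heights and transcendence degree -/

section Dimension

/-- Passing to the radical does not change the spectrum of the quotient. -/
lemma ringKrullDim_quotient_radical {R : Type*} [CommRing R] (I : Ideal R) :
    ringKrullDim (R ⧸ I.radical) = ringKrullDim (R ⧸ I) := by
  rw [ringKrullDim_quotient, ringKrullDim_quotient, PrimeSpectrum.zeroLocus_radical]

lemma ringKrullDim_quotient_anti {R : Type*} [CommRing R] {I J : Ideal R} (h : I ≤ J) :
    ringKrullDim (R ⧸ J) ≤ ringKrullDim (R ⧸ I) :=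
  ringKrullDim_le_of_surjective (Ideal.Quotient.factor h) (Ideal.Quotient.factor_surjective h)

/-- In a polynomial ring over a Noetherian Jacobson ring, the height of a maximal ideal exceeds
that of its contraction by the number of variables. -/
lemma height_eq_height_comap_C_add_card {A : Type*} [CommRing A] [IsNoetherianRing A]
    [IsJacobsonRing A] {ι : Type*} [Finite ι] :
    ∀ (M : Ideal (MvPolynomial ι A)), M.IsMaximal →
      M.height = (M.comap MvPolynomial.C).height + Nat.card ι := by
  induction ι using Finite.induction_empty_option with
  | of_equiv e H =>
    intro M hM
    let r := (MvPolynomial.renameEquiv A e).toRingEquiv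
    have h1 := H (M.comap r) (Ideal.comap_isMaximal_of_equiv r)
    have h2 : (M.comap r).comap MvPolynomial.C = M.comap MvPolynomial.C := by
      ext a
      simp [r, Ideal.mem_comap]
    rwa [RingEquiv.height_comap, h2, Nat.card_congr e] at h1
  | h_empty =>
    intro M hM
    let r := (MvPolynomial.isEmptyRingEquiv A PEmpty).symm
    have h1 := RingEquiv.height_comap r M
    simp only [Nat.card_eq_fintype_card, Fintype.card_pempty, Nat.cast_zero, add_zero]
    rw [← h1]
    congr 1
  | @h_option ι _ IH =>
    intro M hM
    let r := (MvPolynomial.optionEquivLeft A ι).toRingEquiv.symm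
    have hP : (M.comap r).IsMaximal := Ideal.comap_isMaximal_of_equiv r
    have : Nontrivial (MvPolynomial ι A) := by
      by_contra hn
      rw [not_nontrivial_iff_subsingleton] at hn
      exact hP.ne_top (Subsingleton.elim _ _)
    have hQ : ((M.comap r).comap Polynomial.C).IsMaximal :=
      Polynomial.isMaximal_comap_C_of_isJacobsonRing (M.comap r)
    have : (M.comap r).LiesOver ((M.comap r).comap Polynomial.C) := ⟨rfl⟩
    have h1 := Polynomial.height_eq_height_add_one ((M.comap r).comap Polynomial.C) (M.comap r)
    have h2 : ((M.comap r).comap Polynomial.C).comap MvPolynomial.C = M.comap MvPolynomial.C := by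
      ext a
      simp [r, Ideal.mem_comap, MvPolynomial.optionEquivLeft_symm_apply]
    rw [RingEquiv.height_comap, IH _ hQ, h2] at h1
    rw [h1, Finite.card_option, Nat.cast_add, Nat.cast_one, add_assoc]

/-- The bottom `q` of a longest chain of primes ending at `p`. -/
lemma exists_isPrime_le_height_le_ringKrullDim_quotient {R : Type*} [CommRing R]
    [IsNoetherianRing R] (p : Ideal R) [p.IsPrime] :
    ∃ q : Ideal R, q.IsPrime ∧ q ≤ p ∧ (p.height : WithBot ℕ∞) ≤ ringKrullDim (R ⧸ q) := by
  obtain ⟨l, hl, hlen⟩ := p.exists_ltSeries_length_eq_height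
  refine ⟨l.head.asIdeal, l.head.2, ?_, ?_⟩
  · have : l.head ≤ RelSeries.last l := LTSeries.head_le_last l
    rw [hl] at this
    exact this
  · rw [ringKrullDim_quotient, ← hlen]
    let l' : LTSeries (PrimeSpectrum.zeroLocus (R := R) l.head.asIdeal) :=
      ⟨l.length, fun i => ⟨l i, by
        have : l.head ≤ l i := LTSeries.head_le l i
        exact this⟩, fun i => l.step i⟩
    exact Order.LTSeries.length_le_krullDim l'

/-- Krull's height theorem, in a form that keeps track of the component of the zero locus on which
the dimension is attained. -/
lemma exists_isPrime_height_le_ringKrullDim_quotient_add {R : Type*} [CommRing R]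
    [IsNoetherianRing R] (p : Ideal R) [p.IsPrime] (s : Set R) (hs : s ⊆ p) :
    ∃ q : Ideal R, q.IsPrime ∧ s ⊆ q ∧ q ≤ p ∧
      (p.height : WithBot ℕ∞) ≤ ringKrullDim (R ⧸ q) + (s.encard : ℕ∞) := by
  have hsp : Ideal.span s ≤ p := Ideal.span_le.2 hs
  have hp' : (p.map (Ideal.Quotient.mk (Ideal.span s))).IsPrime :=
    Ideal.isPrime_map_quotientMk_of_isPrime hsp
  obtain ⟨q, hq, hqp, hle⟩ := exists_isPrime_le_height_le_ringKrullDim_quotient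
    (p.map (Ideal.Quotient.mk (Ideal.span s)))
  refine ⟨q.comap (Ideal.Quotient.mk (Ideal.span s)), hq.comap _, ?_, ?_, ?_⟩
  · intro f hf
    have : Ideal.Quotient.mk (Ideal.span s) f = 0 :=
      Ideal.Quotient.eq_zero_iff_mem.2 (Ideal.subset_span hf)
    simp [this]
  · refine (Ideal.comap_mono hqp).trans ?_
    rw [Ideal.comap_map_of_surjective _ Ideal.Quotient.mk_surjective, ← RingHom.ker_eq_comap_bot,
      Ideal.mk_ker]
    exact sup_le le_rfl hsp
  · have h1 : (p.height : WithBot ℕ∞) ≤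
        (p.map (Ideal.Quotient.mk (Ideal.span s))).height + (s.encard : ℕ∞) := by
      exact_mod_cast Ideal.height_le_height_add_encard_of_subset s hs
    refine h1.trans ?_
    gcongr
    refine hle.trans (ringKrullDim_le_of_surjective
      (Ideal.quotientMap q (Ideal.Quotient.mk (Ideal.span s)) le_rfl) ?_)
    exact Ideal.quotientMap_surjective Ideal.Quotient.mk_surjective

open MvPolynomial Algebra in
/-- An element `a ≠ 0` of the kernel of `f` can be added to a family whose image under `f` is
algebraically independent: a polynomial relation for `a` over the family may be divided by `a`
until its constant term is nonzero, and `f` would then map that constant term to `0`. -/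
lemma algebraicIndependent_option_of_map_eq_zero {K A B ι : Type*} [Field K] [CommRing A]
    [IsDomain A] [CommRing B] [Algebra K A] [Algebra K B] (f : A →ₐ[K] B) {x : ι → A}
    (hx : AlgebraicIndependent K (f ∘ x)) {a : A} (ha : a ≠ 0) (hfa : f a = 0) :
    AlgebraicIndependent K (fun o : Option ι => o.elim a x) := by
  refine AlgebraicIndependent.option_iff.2 ⟨AlgebraicIndependent.of_comp f hx, ?_⟩
  intro halg
  obtain ⟨q, hq0, hqa⟩ := halg.exists_nonzero_coeff_and_aeval_eq_zero
    (mem_nonZeroDivisors_of_ne_zero ha)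
  apply hq0
  have h1 : f (q.coeff 0 : adjoin K (Set.range x)) = 0 := by
    have h2 := congrArg f hqa
    rw [Polynomial.aeval_eq_sum_range, map_sum, Finset.sum_range_succ', map_zero] at h2
    rw [Finset.sum_eq_zero] at h2
    · simpa [Algebra.smul_def] using h2
    · intro i _
      simp [Algebra.smul_def, pow_succ, hfa]
  obtain ⟨P, hP⟩ : ∃ P : MvPolynomial ι K, aeval x P = (q.coeff 0 : A) := by
    have := (q.coeff 0).2
    simp only [adjoin_range_eq_range_aeval] at this
    exact this
  rw [← hP, MvPolynomial.comp_aeval_apply] at h1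
  have h3 : P = 0 := (injective_iff_map_eq_zero _).1 hx P h1
  apply Subtype.ext
  rw [← hP, h3, map_zero]
  rfl

/-- Along a chain of primes of length `l`, adding one element of each step produces `l`
algebraically independent elements. -/
lemma exists_algebraicIndependent_of_ltSeries (K : Type*) {A : Type*} [Field K] [CommRing A]
    [Algebra K A] (l : LTSeries (PrimeSpectrum A)) :
    ∃ (ι : Type) (_ : Fintype ι) (x : ι → A), Fintype.card ι = l.length ∧
      AlgebraicIndependent K (Ideal.Quotient.mkₐ K l.head.asIdeal ∘ x) := by
  induction l using RelSeries.inductionOn with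
  | singleton P =>
    refine ⟨Empty, inferInstance, Empty.elim, rfl, ?_⟩
    have : Nontrivial (A ⧸ P.asIdeal) := Ideal.Quotient.nontrivial_iff.2 P.2.ne_top
    exact (algebraicIndependent_empty_type_iff).2 (algebraMap K (A ⧸ P.asIdeal)).injective
  | cons l P hlt ih =>
    obtain ⟨ι, _, x, hcard, hx⟩ := ih
    obtain ⟨hle, a, hal, haP⟩ := SetLike.lt_iff_le_and_exists.1
      (show P.asIdeal < l.head.asIdeal from hlt)
    refine ⟨Option ι, inferInstance, fun o => o.elim a x, by simp [hcard], ?_⟩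
    have hdom : IsDomain (A ⧸ P.asIdeal) := inferInstance
    have key := algebraicIndependent_option_of_map_eq_zero (K := K)
      (Ideal.Quotient.factorₐ K hle) (x := Ideal.Quotient.mkₐ K P.asIdeal ∘ x)
      (a := Ideal.Quotient.mkₐ K P.asIdeal a) hx
      (fun h => haP (Ideal.Quotient.eq_zero_iff_mem.1 h))
      (Ideal.Quotient.eq_zero_iff_mem.2 hal)
    have hfun : (fun o : Option ι => o.elim (Ideal.Quotient.mkₐ K P.asIdeal a)
        (Ideal.Quotient.mkₐ K P.asIdeal ∘ x)) =
        Ideal.Quotient.mkₐ K P.asIdeal ∘ fun o : Option ι => o.elim a x := by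
      funext o
      cases o <;> rfl
    rw [hfun] at key
    exact key

lemma ringKrullDim_le_of_trdeg_le {K A : Type*} [Field K] [CommRing A] [Algebra K A] {n : ℕ}
    (h : Algebra.trdeg K A ≤ n) : ringKrullDim A ≤ n := by
  rw [ringKrullDim, Order.krullDim]
  refine iSup_le fun l => ?_
  obtain ⟨ι, _, x, hcard, hx⟩ := exists_algebraicIndependent_of_ltSeries K l
  have h1 := (AlgebraicIndependent.of_comp _ hx).lift_cardinalMk_le_trdeg
  have h2 := h1.trans (Cardinal.lift_le.2 h)
  rw [Cardinal.mk_fintype, hcard] at h2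
  simp only [Cardinal.lift_natCast, Nat.cast_le] at h2
  exact_mod_cast h2

end Dimension

/-! ### Dimension of closed sets in affine space -/

section AffineDimension

variable {K : Type*} [Field K] {σ : Type*}

lemma dim_mono {V W : Set (σ → K)} (h : V ⊆ W) : dim V ≤ dim W :=
  ringKrullDim_quotient_anti (MvPolynomial.vanishingIdeal_anti_mono h)

lemma dim_le_card [Fintype σ] (V : Set (σ → K)) : dim V ≤ (Fintype.card σ : WithBot ℕ∞) := by
  refine (ringKrullDim_quotient_le _).trans ?_
  simp

/-- A nonempty set has a natural number as its dimension. -/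
lemma exists_dim_eq_natCast [Fintype σ] {V : Set (σ → K)} (hV : V.Nonempty) :
    ∃ d : ℕ, dim V = d := by
  obtain ⟨v, hv⟩ := hV
  have h1 : (0 : WithBot ℕ∞) ≤ dim V := by
    have : Nontrivial (MvPolynomial σ K ⧸ MvPolynomial.vanishingIdeal K V) := by
      refine Ideal.Quotient.nontrivial_iff.2 fun h => ?_
      have := (Ideal.eq_top_iff_one _).1 h v hv
      simp at this
    exact ringKrullDim_nonneg_of_nontrivial
  have h2 := dim_le_card V
  generalize dim V = a at h1 h2
  induction a with
  | bot => simp at h1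
  | coe a =>
    induction a with
    | top =>
      exfalso
      have h3 : ((⊤ : ℕ∞) : WithBot ℕ∞) ≤ ((Fintype.card σ : ℕ∞) : WithBot ℕ∞) := h2
      rw [WithBot.coe_le_coe, top_le_iff] at h3
      exact ENat.natCast_ne_top _ h3
    | coe a => exact ⟨a, rfl⟩

lemma dim_zariskiClosure (S : Set (σ → K)) : dim (zariskiClosure S) = dim S := by
  have : MvPolynomial.vanishingIdeal K (zariskiClosure S) = MvPolynomial.vanishingIdeal K S :=
    MvPolynomial.zeroLocus_vanishingIdeal_galoisConnection.u_l_u_eq_u (OrderDual.toDual S)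
  rw [dim, dim, this]

lemma vanishingIdeal_setOf_eval_eq_zero [IsAlgClosed K] [Finite σ] {κ : Type*}
    (f : κ → MvPolynomial σ K) :
    MvPolynomial.vanishingIdeal K {v | ∀ i, MvPolynomial.eval v (f i) = 0} =
      (Ideal.span (Set.range f)).radical := by
  rw [← MvPolynomial.vanishingIdeal_zeroLocus_eq_radical (K := K), MvPolynomial.zeroLocus_span]
  congr 1
  ext v
  simp [MvPolynomial.aeval_eq_eval]

/-- A prime containing defining equations of a closed set contains all polynomials vanishing on
it, even if these equations do not generate a radical ideal. -/
lemma vanishingIdeal_setOf_eval_eq_zero_le [IsAlgClosed K] [Finite σ] {κ : Type*}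
    {f : κ → MvPolynomial σ K} {P : Ideal (MvPolynomial σ K)} (hP : P.IsPrime) (hf : ∀ i, f i ∈ P) :
    MvPolynomial.vanishingIdeal K {v | ∀ i, MvPolynomial.eval v (f i) = 0} ≤ P := by
  rw [vanishingIdeal_setOf_eval_eq_zero]
  exact hP.radical_le_iff.2 (Ideal.span_le.2 (Set.range_subset_iff.2 hf))

lemma dim_setOf_eval_eq_zero [IsAlgClosed K] [Finite σ] {κ : Type*} (f : κ → MvPolynomial σ K) :
    dim {v | ∀ i, MvPolynomial.eval v (f i) = 0} =
      ringKrullDim (MvPolynomial σ K ⧸ Ideal.span (Set.range f)) := by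
  rw [dim, vanishingIdeal_setOf_eval_eq_zero, ringKrullDim_quotient_radical]

lemma height_vanishingIdeal_singleton [Fintype σ] (v : σ → K) :
    (MvPolynomial.vanishingIdeal K {v}).height = Fintype.card σ := by
  have h := height_eq_height_comap_C_add_card (MvPolynomial.vanishingIdeal K {v}) inferInstance
  have hb : (MvPolynomial.vanishingIdeal K {v}).comap MvPolynomial.C = (⊥ : Ideal K) := by
    ext a
    simp
  rw [hb, Ideal.height_bot, zero_add, Nat.card_eq_fintype_card] at h
  exact h

lemma encard_range_le_card {α κ : Type*} [Fintype κ] (f : κ → α) :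
    (Set.range f).encard ≤ Fintype.card κ := by
  rw [← Set.image_univ]
  refine (Set.encard_image_le f Set.univ).trans ?_
  simp

/-- Through a common zero of `c` polynomials there passes an irreducible component of their zero
set (the zero set of the prime ideal `P`) of codimension at most `c`. -/
lemma exists_isPrime_card_le_of_common_zero [Fintype σ] {κ : Type*} [Fintype κ]
    (f : κ → MvPolynomial σ K) (v : σ → K) (hv : ∀ i, MvPolynomial.eval v (f i) = 0) :
    ∃ P : Ideal (MvPolynomial σ K), P.IsPrime ∧ (∀ i, f i ∈ P) ∧
      (∀ g ∈ P, MvPolynomial.eval v g = 0) ∧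
      (Fintype.card σ : WithBot ℕ∞) ≤
        ringKrullDim (MvPolynomial σ K ⧸ P) + (Fintype.card κ : WithBot ℕ∞) := by
  obtain ⟨P, hP, hsP, hle, hdim⟩ := exists_isPrime_height_le_ringKrullDim_quotient_add
    (MvPolynomial.vanishingIdeal K {v}) (Set.range f) (by
      rintro _ ⟨i, rfl⟩
      simpa [MvPolynomial.aeval_eq_eval] using hv i)
  refine ⟨P, hP, fun i => hsP ⟨i, rfl⟩, fun g hg => ?_, ?_⟩
  · have := hle hg v rfl
    rwa [MvPolynomial.aeval_eq_eval] at this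
  · rw [height_vanishingIdeal_singleton] at hdim
    refine le_trans (le_of_eq ?_) (hdim.trans (add_le_add_right ?_ _))
    · rfl
    · exact_mod_cast encard_range_le_card f

lemma card_le_dim_add_card [IsAlgClosed K] [Fintype σ] {κ : Type*} [Fintype κ]
    (f : κ → MvPolynomial σ K) (v : σ → K) (hv : ∀ i, MvPolynomial.eval v (f i) = 0)
    {V : Set (σ → K)} (hV : {v | ∀ i, MvPolynomial.eval v (f i) = 0} ⊆ V) :
    (Fintype.card σ : WithBot ℕ∞) ≤ dim V + (Fintype.card κ : WithBot ℕ∞) := by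
  obtain ⟨P, hP, hfP, -, hdim⟩ := exists_isPrime_card_le_of_common_zero f v hv
  refine hdim.trans (add_le_add_left ?_ _)
  exact (ringKrullDim_quotient_anti (vanishingIdeal_setOf_eval_eq_zero_le hP hfP)).trans
    (dim_mono hV)

lemma isCompleteIntersection_of_eq_setOf [Fintype σ] {κ : Type*} [Fintype κ] {V : Set (σ → K)}
    (f : κ → MvPolynomial σ K) (hV : V = {v | ∀ i, MvPolynomial.eval v (f i) = 0})
    (hdim : dim V + (Fintype.card κ : WithBot ℕ∞) = (Fintype.card σ : WithBot ℕ∞)) :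
    IsCompleteIntersection V := by
  refine ⟨Fintype.card κ, fun i => f ((Fintype.equivFin κ).symm i), ?_, hdim⟩
  rw [hV]
  ext v
  refine ⟨fun h i => h _, fun h i => ?_⟩
  have := h (Fintype.equivFin κ i)
  simpa using this

/-- For a closed set, generators of the vanishing ideal are defining equations. -/
lemma isCompleteIntersection_of_isIdealCompleteIntersection [Fintype σ] {V : Set (σ → K)}
    (hV : zariskiClosure V = V) (h : IsIdealCompleteIntersection V) :
    IsCompleteIntersection V := by
  obtain ⟨c, f, hf, hc⟩ := h
  refine ⟨c, f, ?_, hc⟩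
  rw [← hV, zariskiClosure, hf, MvPolynomial.zeroLocus_span]
  ext v
  simp [MvPolynomial.aeval_eq_eval]

end AffineDimension

/-! ### Generic upper triangular matrices -/

section GenericMatrices

/-- The upper triangular matrix with given entries, over an arbitrary commutative ring. -/
def triMatrix {A : Type*} [CommRing A] {n : ℕ} (a : UpperIdx n → A) : Matrix (Fin n) (Fin n) A :=
  Matrix.of fun i j => if h : i ≤ j then a ⟨(i, j), h⟩ else 0

section

variable {A B : Type*} [CommRing A] [CommRing B] {n : ℕ}

lemma triMatrix_apply_of_le (a : UpperIdx n → A) {i j : Fin n} (h : i ≤ j) :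
    triMatrix a i j = a ⟨(i, j), h⟩ := by
  simp [triMatrix, h]

lemma triMatrix_apply_of_lt (a : UpperIdx n → A) {i j : Fin n} (h : j < i) :
    triMatrix a i j = 0 := by
  simp [triMatrix, not_le.2 h]

lemma triMatrix_map (a : UpperIdx n → A) (φ : A →+* B) :
    (triMatrix a).map φ = triMatrix (φ ∘ a) := by
  ext i j
  by_cases h : i ≤ j <;> simp [triMatrix, h]

lemma triMatrix_blockTriangular (a : UpperIdx n → A) :
    (triMatrix a).BlockTriangular id := fun _ _ h => triMatrix_apply_of_lt a h

lemma triMatrix_mul_apply (a b : UpperIdx n → A) (i j : Fin n) :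
    (triMatrix a * triMatrix b) i j =
      ∑ k ∈ Finset.Icc i j, triMatrix a i k * triMatrix b k j := by
  rw [Matrix.mul_apply]
  symm
  refine Finset.sum_subset (Finset.subset_univ _) fun k _ hk => ?_
  rw [Finset.mem_Icc, not_and_or, not_le, not_le] at hk
  rcases hk with hk | hk
  · rw [triMatrix_apply_of_lt a hk, zero_mul]
  · rw [triMatrix_apply_of_lt b hk, mul_zero]

/-- Two upper triangular matrices commute as soon as their commutator vanishes strictly above the
diagonal. -/
lemma commute_triMatrix_iff (a b : UpperIdx n → A) :
    triMatrix a * triMatrix b = triMatrix b * triMatrix a ↔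
      ∀ i j : Fin n, i < j →
        (triMatrix a * triMatrix b - triMatrix b * triMatrix a) i j = 0 := by
  rw [← sub_eq_zero]
  refine ⟨fun h i j _ => by rw [h]; rfl, fun h => ?_⟩
  ext i j
  rcases lt_trichotomy i j with hij | rfl | hij
  · exact h i j hij
  · simp [triMatrix_mul_apply, mul_comm]
  · simp [triMatrix_mul_apply, Finset.Icc_eq_empty (not_le.2 hij)]

/-- For matrices that are strictly upper triangular with respect to the blocks of `b`, only the
entries of the commutator at least two blocks above the diagonal can be nonzero. -/
lemma commute_of_strict_blocks {b : Fin n → ℕ} {M N : Matrix (Fin n) (Fin n) A}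
    (hM : ∀ i j, b j ≤ b i → M i j = 0) (hN : ∀ i j, b j ≤ b i → N i j = 0)
    (h : ∀ i j, b i + 2 ≤ b j → (M * N - N * M) i j = 0) : M * N = N * M := by
  rw [← sub_eq_zero]
  ext i j
  by_cases hij : b i + 2 ≤ b j
  · exact h i j hij
  · rw [Matrix.sub_apply, Matrix.mul_apply, Matrix.mul_apply, Finset.sum_eq_zero,
      Finset.sum_eq_zero, sub_zero, Matrix.zero_apply]
    all_goals
      intro k _
      by_cases hk : b k ≤ b i
      · simp [hM i k hk, hN i k hk]
      · have hk' : b j ≤ b k := by omega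
        simp [hM k j hk', hN k j hk']

end

variable (K : Type*) [Field K] (n : ℕ)

/-- The `(i, j)` entry of the commutator of the two generic upper triangular matrices. -/
noncomputable def commPoly (i j : Fin n) : MvPolynomial (PairIdx n) K :=
  (triMatrix (fun p => MvPolynomial.X (Sum.inl p)) *
      triMatrix (fun p => MvPolynomial.X (Sum.inr p)) -
    triMatrix (fun p => MvPolynomial.X (Sum.inr p)) *
      triMatrix (fun p => MvPolynomial.X (Sum.inl p)) :
    Matrix (Fin n) (Fin n) (MvPolynomial (PairIdx n) K)) i j

/-- The positions strictly above the diagonal. -/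
abbrev StrictIdx : Type := {p : Fin n × Fin n // p.1 < p.2}

variable {K n}

lemma map_commPoly {A : Type*} [CommRing A] (φ : MvPolynomial (PairIdx n) K →+* A)
    (i j : Fin n) :
    φ (commPoly K n i j) =
      (triMatrix (fun p => φ (MvPolynomial.X (Sum.inl p))) *
          triMatrix (fun p => φ (MvPolynomial.X (Sum.inr p))) -
        triMatrix (fun p => φ (MvPolynomial.X (Sum.inr p))) *
          triMatrix (fun p => φ (MvPolynomial.X (Sum.inl p)))) i j := by
  have h1 := triMatrix_map (fun p : UpperIdx n => (MvPolynomial.X (Sum.inl p) :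
    MvPolynomial (PairIdx n) K)) φ
  have h2 := triMatrix_map (fun p : UpperIdx n => (MvPolynomial.X (Sum.inr p) :
    MvPolynomial (PairIdx n) K)) φ
  change _ = triMatrix (fun p => φ (MvPolynomial.X (Sum.inl p))) at h1
  change _ = triMatrix (fun p => φ (MvPolynomial.X (Sum.inr p))) at h2
  rw [← h1, ← h2, ← Matrix.map_mul, ← Matrix.map_mul, commPoly, Matrix.sub_apply, map_sub]
  rfl

lemma eval_commPoly (v : PairIdx n → K) (i j : Fin n) :
    MvPolynomial.eval v (commPoly K n i j) = (matX v * matY v - matY v * matX v) i j := by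
  rw [map_commPoly]
  simp only [MvPolynomial.eval_X]
  rfl

lemma CT_eq_setOf_eval_eq_zero :
    CT K n = {v | ∀ p : StrictIdx n, MvPolynomial.eval v (commPoly K n p.1.1 p.1.2) = 0} := by
  ext v
  simp only [CT, Set.mem_ofPred_eq, eval_commPoly]
  exact (commute_triMatrix_iff (fun p => v (Sum.inl p)) (fun p => v (Sum.inr p))).trans
    ⟨fun h p => h _ _ p.2, fun h i j hij => h ⟨(i, j), hij⟩⟩

/-- The pair of diagonal matrices with entries `a` and `b`. -/
def diagPair (a b : Fin n → K) : PairIdx n → K :=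
  Sum.elim (fun p => if p.1.1 = p.1.2 then a p.1.1 else 0)
    (fun p => if p.1.1 = p.1.2 then b p.1.1 else 0)

lemma matX_diagPair (a b : Fin n → K) : matX (diagPair a b) = Matrix.diagonal a := by
  ext i j
  rcases lt_trichotomy i j with h | rfl | h
  · simp [matX, upperMatrix, diagPair, h.le, h.ne]
  · simp [matX, upperMatrix, diagPair]
  · simp [matX, upperMatrix, not_le.2 h, h.ne']

lemma matY_diagPair (a b : Fin n → K) : matY (diagPair a b) = Matrix.diagonal b := by
  ext i j
  rcases lt_trichotomy i j with h | rfl | h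
  · simp [matY, upperMatrix, diagPair, h.le, h.ne]
  · simp [matY, upperMatrix, diagPair]
  · simp [matY, upperMatrix, not_le.2 h, h.ne']

lemma diagPair_mem_CT (a b : Fin n → K) : diagPair a b ∈ CT K n := by
  simp [CT, matX_diagPair, matY_diagPair, mul_comm]

lemma eval_diagPair_commPoly (a b : Fin n → K) (p : StrictIdx n) :
    MvPolynomial.eval (diagPair a b) (commPoly K n p.1.1 p.1.2) = 0 := by
  have := diagPair_mem_CT a b
  rw [CT_eq_setOf_eval_eq_zero] at this
  exact this p

/-! ### Counting the positions of the entries -/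

/-- Deleting the last row and column splits the positions of an upper triangular matrix. -/
def upperIdxSuccEquiv (n : ℕ) : UpperIdx n ⊕ Fin (n + 1) ≃ UpperIdx (n + 1) where
  toFun := Sum.elim (fun p => ⟨(p.1.1.castSucc, p.1.2.castSucc), p.2⟩)
    (fun i => ⟨(i, Fin.last n), Fin.le_last i⟩)
  invFun p := if h : p.1.2 = Fin.last n then Sum.inr p.1.1 else
    Sum.inl ⟨(p.1.1.castPred fun h' => h (le_antisymm (Fin.le_last _) (h' ▸ p.2)),
      p.1.2.castPred h), p.2⟩
  left_inv p := by
    rcases p with p | i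
    · simp [Fin.castSucc_ne_last]
    · simp
  right_inv p := by
    by_cases h : p.1.2 = Fin.last n
    · simp only [h, dite_true, Sum.elim_inr]
      exact Subtype.ext (Prod.ext rfl h.symm)
    · simp [h]

lemma card_upperIdx_succ (n : ℕ) :
    Fintype.card (UpperIdx (n + 1)) = Fintype.card (UpperIdx n) + (n + 1) := by
  rw [← Fintype.card_congr (upperIdxSuccEquiv n), Fintype.card_sum, Fintype.card_fin]

lemma card_upperIdx_eq_add (n : ℕ) :
    Fintype.card (UpperIdx n) = Fintype.card (StrictIdx n) + n := by
  have e : StrictIdx n ⊕ Fin n ≃ UpperIdx n :=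
    { toFun := Sum.elim (fun p => ⟨p.1, p.2.le⟩) (fun i => ⟨(i, i), le_rfl⟩)
      invFun := fun p => if h : p.1.1 = p.1.2 then Sum.inr p.1.1 else
        Sum.inl ⟨p.1, lt_of_le_of_ne p.2 h⟩
      left_inv := by
        rintro (p | i)
        · simp [p.2.ne]
        · simp
      right_inv := by
        intro p
        by_cases h : p.1.1 = p.1.2
        · simp only [h, dite_true, Sum.elim_inr]
          exact Subtype.ext (Prod.ext h.symm rfl)
        · simp [h] }
  rw [← Fintype.card_congr e, Fintype.card_sum, Fintype.card_fin]

lemma card_upperIdx_eighteen : Fintype.card (UpperIdx 18) = 171 := by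
  have h0 : Fintype.card (UpperIdx 0) = 0 := by simp
  simp only [card_upperIdx_succ, h0]

end GenericMatrices

/-! ### The component of the pairs with distinct eigenvalues -/

section GenericComponent

variable {K : Type*} [Field K] {n : ℕ}

/-- In a commuting pair of triangular matrices whose first member has distinct diagonal entries,
every entry is algebraic over the entries of the first matrix and the diagonal of the second:
the `(i, j)` entry of the commutator expresses `(x_ii - x_jj) y_ij` through entries of the second
matrix that are closer to the diagonal. -/
lemma isAlgebraic_entry_of_commute {S A : Type*} [CommRing S] [IsDomain S] [CommRing A]
    [IsDomain A] [Algebra S A] {x y : UpperIdx n → A}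
    (hcomm : triMatrix x * triMatrix y = triMatrix y * triMatrix x)
    (hx : ∀ p, IsAlgebraic S (x p)) (hy : ∀ i, IsAlgebraic S (y ⟨(i, i), le_rfl⟩))
    (hne : ∀ i j, i < j → triMatrix x i i - triMatrix x j j ≠ 0) (p : UpperIdx n) :
    IsAlgebraic S (y p) := by
  have hX : ∀ i j, IsAlgebraic S (triMatrix x i j) := by
    intro i j
    by_cases h : i ≤ j
    · rw [triMatrix_apply_of_le x h]; exact hx _
    · rw [triMatrix_apply_of_lt x (not_le.1 h)]; exact isAlgebraic_zero
  have hYd : ∀ i, IsAlgebraic S (triMatrix y i i) := by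
    intro i
    rw [triMatrix_apply_of_le y le_rfl]
    exact hy i
  have sum_alg : ∀ (s : Finset (Fin n)) (f : Fin n → A), (∀ k ∈ s, IsAlgebraic S (f k)) →
      IsAlgebraic S (∑ k ∈ s, f k) := by
    intro s f hf
    exact (Subalgebra.algebraicClosure S A).sum_mem hf
  suffices H : ∀ d : ℕ, ∀ i j : Fin n, (j : ℕ) - i = d → IsAlgebraic S (triMatrix y i j) by
    have := H _ p.1.1 p.1.2 rfl
    rwa [triMatrix_apply_of_le y p.2] at this
  intro d
  induction d using Nat.strong_induction_on with
  | _ d ih =>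
    intro i j hd
    rcases lt_trichotomy i j with hij | rfl | hij
    · have h1 := congrFun (congrFun hcomm i) j
      rw [triMatrix_mul_apply, triMatrix_mul_apply, ← Finset.Ioc_insert_left hij.le,
        Finset.sum_insert (by simp), Finset.sum_insert (by simp)] at h1
      have hI : Finset.Ioc i j = insert j (Finset.Ioo i j) := (Finset.Ioo_insert_right hij).symm
      rw [hI, Finset.sum_insert (by simp), Finset.sum_insert (by simp)] at h1
      have h2 : (triMatrix x i i - triMatrix x j j) * triMatrix y i j =
          triMatrix y i i * triMatrix x i j - triMatrix x i j * triMatrix y j j +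
            ∑ k ∈ Finset.Ioo i j, triMatrix y i k * triMatrix x k j -
            ∑ k ∈ Finset.Ioo i j, triMatrix x i k * triMatrix y k j := by
        linear_combination h1
      have hY1 : ∀ k ∈ Finset.Ioo i j, IsAlgebraic S (triMatrix y i k) := by
        intro k hk
        rw [Finset.mem_Ioo] at hk
        exact ih ((k : ℕ) - i) (by have := hk.1; have := hk.2; omega) i k rfl
      have hY2 : ∀ k ∈ Finset.Ioo i j, IsAlgebraic S (triMatrix y k j) := by
        intro k hk
        rw [Finset.mem_Ioo] at hk
        exact ih ((j : ℕ) - k) (by have := hk.1; have := hk.2; omega) k j rfl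
      have h3 : IsAlgebraic S ((triMatrix x i i - triMatrix x j j) * triMatrix y i j) := by
        rw [h2]
        exact ((((hYd i).mul (hX i j)).sub ((hX i j).mul (hYd j))).add
          (sum_alg _ _ fun k hk => (hY1 k hk).mul (hX k j))).sub
          (sum_alg _ _ fun k hk => (hX i k).mul (hY2 k hk))
      exact IsAlgebraic.of_mul (mem_nonZeroDivisors_of_ne_zero (hne i j hij))
        ((hX i i).sub (hX j j)) h3
    · exact hYd i
    · rw [triMatrix_apply_of_lt y hij]; exact isAlgebraic_zero

/-- A component of `CT_n` on which the first matrix generically has distinct diagonal entries has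
dimension at most `n (n + 3) / 2`. -/
lemma ringKrullDim_quotient_le_of_diag_notMem {P : Ideal (MvPolynomial (PairIdx n) K)}
    (hP : P.IsPrime) (hcomm : ∀ p : StrictIdx n, commPoly K n p.1.1 p.1.2 ∈ P)
    (hdiag : ∀ i j : Fin n, i < j → (MvPolynomial.X (Sum.inl ⟨(i, i), le_rfl⟩) -
      MvPolynomial.X (Sum.inl ⟨(j, j), le_rfl⟩) : MvPolynomial (PairIdx n) K) ∉ P) :
    ringKrullDim (MvPolynomial (PairIdx n) K ⧸ P) ≤
      ((Fintype.card (UpperIdx n) + n : ℕ) : WithBot ℕ∞) := by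
  let A := MvPolynomial (PairIdx n) K ⧸ P
  have : IsDomain A := inferInstance
  let φ : MvPolynomial (PairIdx n) K →+* A := Ideal.Quotient.mk P
  let x : UpperIdx n → A := fun p => φ (MvPolynomial.X (Sum.inl p))
  let y : UpperIdx n → A := fun p => φ (MvPolynomial.X (Sum.inr p))
  let g : UpperIdx n ⊕ Fin n → A := Sum.elim x fun i => y ⟨(i, i), le_rfl⟩
  let S := Algebra.adjoin K (Set.range g)
  have hg : ∀ q, IsAlgebraic S (g q) := fun q =>
    isAlgebraic_algebraMap (⟨g q, Algebra.subset_adjoin ⟨q, rfl⟩⟩ : S)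
  have hcomm' : triMatrix x * triMatrix y = triMatrix y * triMatrix x := by
    refine (commute_triMatrix_iff x y).2 fun i j hij => ?_
    rw [← map_commPoly φ]
    exact Ideal.Quotient.eq_zero_iff_mem.2 (hcomm ⟨(i, j), hij⟩)
  have hy : ∀ p, IsAlgebraic S (y p) := by
    refine isAlgebraic_entry_of_commute hcomm' (fun p => hg (Sum.inl p))
      (fun i => hg (Sum.inr i)) fun i j hij => ?_
    rw [triMatrix_apply_of_le x le_rfl, triMatrix_apply_of_le x le_rfl, ← map_sub]
    exact fun h => hdiag i j hij (Ideal.Quotient.eq_zero_iff_mem.1 h)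
  have halg : Algebra.IsAlgebraic S A := by
    refine ⟨fun a => ?_⟩
    obtain ⟨f, rfl⟩ := Ideal.Quotient.mk_surjective a
    change IsAlgebraic S (φ f)
    induction f using MvPolynomial.induction_on with
    | C c => exact isAlgebraic_algebraMap (algebraMap K S c)
    | add p q hp hq => rw [map_add]; exact hp.add hq
    | mul_X p i hp =>
      rw [map_mul]
      refine hp.mul ?_
      rcases i with i | i
      · exact hg (Sum.inl i)
      · exact hy i
  refine ringKrullDim_le_of_trdeg_le (K := K)
    ((Algebra.IsAlgebraic.trdeg_le_cardinalMk K (Set.range g)).trans ?_)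
  have h := Cardinal.mk_range_le_lift (f := g)
  rw [Cardinal.mk_fintype (UpperIdx n ⊕ Fin n), Fintype.card_sum, Fintype.card_fin,
    Cardinal.lift_natCast, ← Cardinal.lift_natCast.{0}, Cardinal.lift_le] at h
  exact h

end GenericComponent

section Dimension

variable {K : Type*} [Field K] [IsAlgClosed K] {n : ℕ}

lemma card_upperIdx_add_le_dim_CT :
    ((Fintype.card (UpperIdx n) + n : ℕ) : WithBot ℕ∞) ≤ dim (CT K n) := by
  have h := card_le_dim_add_card (fun p : StrictIdx n => commPoly K n p.1.1 p.1.2)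
    (diagPair 0 0) (eval_diagPair_commPoly 0 0) CT_eq_setOf_eval_eq_zero.ge
  obtain ⟨d, hd⟩ := exists_dim_eq_natCast (V := CT K n) ⟨_, diagPair_mem_CT 0 0⟩
  have hc := card_upperIdx_eq_add n
  rw [hd, Fintype.card_sum] at h
  rw [hd]
  norm_cast at h ⊢
  omega

/-- `CT_n` is a complete intersection exactly when its dimension is the expected one: all
components of a complete intersection have the same dimension, and the component through a pair
of diagonal matrices with distinct eigenvalues has dimension at most `n (n + 3) / 2`. -/
lemma isCompleteIntersection_CT_iff :
    IsCompleteIntersection (CT K n) ↔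
      dim (CT K n) = ((Fintype.card (UpperIdx n) + n : ℕ) : WithBot ℕ∞) := by
  have hu := card_upperIdx_eq_add n
  constructor
  · rintro ⟨c, f, hf, hc⟩
    refine le_antisymm ?_ card_upperIdx_add_le_dim_CT
    have : Infinite K := inferInstance
    -- a component through a diagonal pair whose first matrix has distinct eigenvalues
    let e : Fin n ↪ K := Fin.valEmbedding.trans (Infinite.natEmbedding K)
    have hv : ∀ i, MvPolynomial.eval (diagPair e 0) (f i) = 0 := by
      have := diagPair_mem_CT (K := K) e 0
      rw [hf] at this
      exact this
    obtain ⟨P, hP, hfP, hPv, hdim⟩ := exists_isPrime_card_le_of_common_zero f _ hv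
    have hle : MvPolynomial.vanishingIdeal K (CT K n) ≤ P := by
      rw [hf]
      exact vanishingIdeal_setOf_eval_eq_zero_le hP hfP
    have hub := ringKrullDim_quotient_le_of_diag_notMem hP
      (fun p => hle fun v hv => by
        rw [CT_eq_setOf_eval_eq_zero] at hv
        rw [MvPolynomial.aeval_eq_eval]
        exact hv p)
      (fun i j hij hmem => by
        have := hPv _ hmem
        simp [diagPair, sub_eq_zero, hij.ne] at this)
    obtain ⟨d, hd⟩ := exists_dim_eq_natCast (V := CT K n) ⟨_, diagPair_mem_CT 0 0⟩
    rw [hd] at hc ⊢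
    have h := hdim.trans (add_le_add_left hub _)
    rw [← hc, Fintype.card_fin] at h
    norm_cast at h ⊢
    omega
  · intro h
    refine isCompleteIntersection_of_eq_setOf
      (fun p : StrictIdx n => commPoly K n p.1.1 p.1.2) CT_eq_setOf_eval_eq_zero ?_
    rw [h, Fintype.card_sum]
    norm_cast
    omega

end Dimension

/-! ### Enlarging the matrices by one row and column -/

section Monotonicity

variable {K A : Type*} [Field K] [CommRing A] [Algebra K A] {n : ℕ}
  (π : MvPolynomial (PairIdx n) K →ₐ[K] A)

/-- The extension of `π : K[T_n × T_n] → A` to a homomorphism from `K[T_{n+1} × T_{n+1}]` to a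
polynomial ring over `A`, with one variable for each entry of the last columns. If `A` is the
coordinate ring of `CT_n`, this is the restriction of polynomials to the pairs whose top left
corners commute. -/
noncomputable def cornerHom :
    MvPolynomial (PairIdx (n + 1)) K →ₐ[K] MvPolynomial (Fin (n + 1) ⊕ Fin (n + 1)) A :=
  MvPolynomial.aeval (Sum.elim
    (fun p => Sum.elim (fun q => MvPolynomial.C (π (MvPolynomial.X (Sum.inl q))))
      (fun i => MvPolynomial.X (Sum.inl i)) ((upperIdxSuccEquiv n).symm p))
    (fun p => Sum.elim (fun q => MvPolynomial.C (π (MvPolynomial.X (Sum.inr q))))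
      (fun i => MvPolynomial.X (Sum.inr i)) ((upperIdxSuccEquiv n).symm p)))

lemma cornerHom_X_inl_castSucc (q : UpperIdx n) :
    cornerHom π (MvPolynomial.X (Sum.inl (upperIdxSuccEquiv n (Sum.inl q)))) =
      MvPolynomial.C (π (MvPolynomial.X (Sum.inl q))) := by
  simp [cornerHom]

lemma cornerHom_X_inr_castSucc (q : UpperIdx n) :
    cornerHom π (MvPolynomial.X (Sum.inr (upperIdxSuccEquiv n (Sum.inl q)))) =
      MvPolynomial.C (π (MvPolynomial.X (Sum.inr q))) := by
  simp [cornerHom]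

lemma cornerHom_X_inl_last (i : Fin (n + 1)) :
    cornerHom π (MvPolynomial.X (Sum.inl (upperIdxSuccEquiv n (Sum.inr i)))) =
      MvPolynomial.X (Sum.inl i) := by
  simp [cornerHom]

lemma cornerHom_X_inr_last (i : Fin (n + 1)) :
    cornerHom π (MvPolynomial.X (Sum.inr (upperIdxSuccEquiv n (Sum.inr i)))) =
      MvPolynomial.X (Sum.inr i) := by
  simp [cornerHom]

lemma cornerHom_surjective (hπ : Function.Surjective π) : Function.Surjective (cornerHom π) := by
  have hX : ∀ i, ∃ f, cornerHom π f = MvPolynomial.X i := by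
    rintro (i | i)
    · exact ⟨_, cornerHom_X_inl_last π i⟩
    · exact ⟨_, cornerHom_X_inr_last π i⟩
  intro b
  induction b using MvPolynomial.induction_on with
  | C a =>
    obtain ⟨f, rfl⟩ := hπ a
    induction f using MvPolynomial.induction_on with
    | C c =>
      have h : π (MvPolynomial.C c) = algebraMap K A c := π.commutes c
      refine ⟨MvPolynomial.C c, ?_⟩
      rw [h]
      exact (cornerHom π).commutes c
    | add p q hp hq =>
      obtain ⟨f, hf⟩ := hp
      obtain ⟨g, hg⟩ := hq
      exact ⟨f + g, by rw [map_add, map_add, map_add, hf, hg]⟩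
    | mul_X p i hp =>
      obtain ⟨f, hf⟩ := hp
      rcases i with i | i
      · exact ⟨f * MvPolynomial.X (Sum.inl (upperIdxSuccEquiv n (Sum.inl i))), by
          rw [map_mul, map_mul, map_mul, hf, cornerHom_X_inl_castSucc π]⟩
      · exact ⟨f * MvPolynomial.X (Sum.inr (upperIdxSuccEquiv n (Sum.inl i))), by
          rw [map_mul, map_mul, map_mul, hf, cornerHom_X_inr_castSucc π]⟩
  | add p q hp hq =>
    obtain ⟨f, hf⟩ := hp
    obtain ⟨g, hg⟩ := hq
    exact ⟨f + g, by rw [map_add, hf, hg]⟩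
  | mul_X p i hp =>
    obtain ⟨f, hf⟩ := hp
    obtain ⟨g, hg⟩ := hX i
    exact ⟨f * g, by rw [map_mul, hf, hg]⟩

lemma triMatrix_castSucc_castSucc {A B : Type*} [CommRing A] [CommRing B]
    {a : UpperIdx (n + 1) → A} {b : UpperIdx n → B} (φ : B →+* A)
    (h : ∀ q, a (upperIdxSuccEquiv n (Sum.inl q)) = φ (b q)) (i j : Fin n) :
    triMatrix a i.castSucc j.castSucc = φ (triMatrix b i j) := by
  by_cases hij : i ≤ j
  · rw [triMatrix_apply_of_le b hij, ← h]
    exact triMatrix_apply_of_le a (i := i.castSucc) (j := j.castSucc) hij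
  · rw [triMatrix_apply_of_lt b (not_le.1 hij), map_zero]
    exact triMatrix_apply_of_lt a (i := i.castSucc) (j := j.castSucc) (not_le.1 hij)

/-- The top left corner of a product of upper triangular matrices is the product of the corners. -/
lemma triMatrix_mul_castSucc_castSucc {A B : Type*} [CommRing A] [CommRing B]
    {a a' : UpperIdx (n + 1) → A} {b b' : UpperIdx n → B} (φ : B →+* A)
    (h : ∀ q, a (upperIdxSuccEquiv n (Sum.inl q)) = φ (b q))
    (h' : ∀ q, a' (upperIdxSuccEquiv n (Sum.inl q)) = φ (b' q)) (i j : Fin n) :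
    (triMatrix a * triMatrix a') i.castSucc j.castSucc =
      φ ((triMatrix b * triMatrix b') i j) := by
  rw [Matrix.mul_apply, Matrix.mul_apply, Fin.sum_univ_castSucc,
    triMatrix_apply_of_lt a' (Fin.castSucc_lt_last j), mul_zero, add_zero, map_sum]
  refine Finset.sum_congr rfl fun k _ => ?_
  rw [triMatrix_castSucc_castSucc φ h, triMatrix_castSucc_castSucc φ h', map_mul]

lemma cornerHom_commPoly_castSucc (i j : Fin n) :
    cornerHom π (commPoly K (n + 1) i.castSucc j.castSucc) =
      MvPolynomial.C (π (commPoly K n i j)) := by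
  have h1 := map_commPoly (cornerHom π).toRingHom i.castSucc j.castSucc
  have h2 := map_commPoly π.toRingHom i j
  refine h1.trans ?_
  refine Eq.trans ?_ (congrArg MvPolynomial.C h2.symm)
  rw [Matrix.sub_apply, triMatrix_mul_castSucc_castSucc MvPolynomial.C (cornerHom_X_inl_castSucc π)
      (cornerHom_X_inr_castSucc π),
    triMatrix_mul_castSucc_castSucc MvPolynomial.C (cornerHom_X_inr_castSucc π)
      (cornerHom_X_inl_castSucc π), ← map_sub]
  rfl

/-- In the last column, every term of the commutator contains an entry of the last column of one
of the two matrices. -/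
lemma constantCoeff_cornerHom_commPoly_last (i : Fin n) :
    MvPolynomial.constantCoeff (cornerHom π (commPoly K (n + 1) i.castSucc (Fin.last n))) = 0 := by
  have h1 := map_commPoly (MvPolynomial.constantCoeff.comp
    (cornerHom π).toRingHom) i.castSucc (Fin.last n)
  refine h1.trans ?_
  rw [Matrix.sub_apply, Matrix.mul_apply, Matrix.mul_apply, Finset.sum_eq_zero,
    Finset.sum_eq_zero, sub_zero]
  · intro k _
    rw [triMatrix_apply_of_le _ (Fin.le_last k)]
    have := cornerHom_X_inl_last π k
    change _ * MvPolynomial.constantCoeff (cornerHom π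
      (MvPolynomial.X (Sum.inl (upperIdxSuccEquiv n (Sum.inr k))))) = 0
    rw [this, MvPolynomial.constantCoeff_X, mul_zero]
  · intro k _
    rw [triMatrix_apply_of_le _ (Fin.le_last k)]
    have := cornerHom_X_inr_last π k
    change _ * MvPolynomial.constantCoeff (cornerHom π
      (MvPolynomial.X (Sum.inr (upperIdxSuccEquiv n (Sum.inr k))))) = 0
    rw [this, MvPolynomial.constantCoeff_X, mul_zero]

/-- Equations without constant term pass through the origin of the fibre `A^ι`, so each of them
lowers the dimension of `Spec A × A^ι` by at most one. -/
lemma ringKrullDim_add_card_le_of_constantCoeff_eq_zero {A ι κ : Type*} [CommRing A]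
    [IsNoetherianRing A] [IsJacobsonRing A] [FiniteRingKrullDim A] [Fintype ι] [Fintype κ]
    (g : κ → MvPolynomial ι A) (hg : ∀ i, MvPolynomial.constantCoeff (g i) = 0) :
    ringKrullDim A + (Fintype.card ι : WithBot ℕ∞) ≤
      ringKrullDim (MvPolynomial ι A ⧸ Ideal.span (Set.range g)) +
        (Fintype.card κ : WithBot ℕ∞) := by
  obtain ⟨m, hm, hmh⟩ := Ideal.exists_isMaximal_height (R := A)
  have hsurj : Function.Surjective (MvPolynomial.constantCoeff : MvPolynomial ι A →+* A) :=
    fun a => ⟨MvPolynomial.C a, MvPolynomial.constantCoeff_C _ a⟩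
  have hM : (m.comap (MvPolynomial.constantCoeff (σ := ι))).IsMaximal :=
    Ideal.comap_isMaximal_of_surjective _ hsurj
  have hMC : (m.comap (MvPolynomial.constantCoeff (σ := ι))).comap MvPolynomial.C = m := by
    ext a
    simp [Ideal.mem_comap]
  have hMh := height_eq_height_comap_C_add_card _ hM
  rw [hMC, Nat.card_eq_fintype_card] at hMh
  have hK := Ideal.height_le_ringKrullDim_quotient_add_encard
    (p := m.comap (MvPolynomial.constantCoeff (σ := ι))) (Set.range g) (by
      rintro _ ⟨i, rfl⟩
      simp [hg])
  rw [hMh] at hK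
  rw [← hmh]
  refine le_trans (le_of_eq ?_) (hK.trans (add_le_add_right ?_ _))
  · rfl
  · exact_mod_cast encard_range_le_card g

/-- Modulo the commutator entries in the last column, all equations of `CT_{n+1}` hold. -/
lemma ringKrullDim_quotient_cornerHom_le [IsAlgClosed K] (hπ : Function.Surjective π)
    (hcomm : ∀ p : StrictIdx n, π (commPoly K n p.1.1 p.1.2) = 0) :
    ringKrullDim (MvPolynomial (Fin (n + 1) ⊕ Fin (n + 1)) A ⧸ Ideal.span (Set.range
      fun i : Fin n => cornerHom π (commPoly K (n + 1) i.castSucc (Fin.last n)))) ≤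
      dim (CT K (n + 1)) := by
  let J := Ideal.span (Set.range
    fun i : Fin n => cornerHom π (commPoly K (n + 1) i.castSucc (Fin.last n)))
  let ψ := (Ideal.Quotient.mk J).comp (cornerHom π).toRingHom
  have hψ : ∀ f ∈ Ideal.span (Set.range fun p : StrictIdx (n + 1) =>
      commPoly K (n + 1) p.1.1 p.1.2), ψ f = 0 := by
    intro f hf
    refine (Ideal.span_le (I := RingHom.ker ψ)).2 ?_ hf
    rintro _ ⟨⟨⟨i, j⟩, hij⟩, rfl⟩
    change Ideal.Quotient.mk _ (cornerHom π (commPoly K (n + 1) i j)) = 0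
    change i < j at hij
    obtain ⟨i, rfl⟩ := Fin.exists_castSucc_eq.2 (hij.trans_le (Fin.le_last j)).ne
    induction j using Fin.lastCases with
    | last => exact Ideal.Quotient.eq_zero_iff_mem.2 (Ideal.subset_span ⟨i, rfl⟩)
    | cast j =>
      rw [cornerHom_commPoly_castSucc, hcomm ⟨(i, j), Fin.castSucc_lt_castSucc_iff.1 hij⟩,
        map_zero, map_zero]
  rw [CT_eq_setOf_eval_eq_zero, dim_setOf_eval_eq_zero]
  exact ringKrullDim_le_of_surjective (Ideal.Quotient.lift _ ψ hψ)
    (Ideal.Quotient.lift_surjective_of_surjective _ hψ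
      (Ideal.Quotient.mk_surjective.comp (cornerHom_surjective π hπ)))

/-- The pairs in `CT_{n+1}` are cut out by `n` equations, with no constant term in the `2 n + 2`
entries of the last columns, in the product of `CT_n` with the space of these entries. -/
lemma dim_CT_add_le_dim_CT_succ (K : Type*) [Field K] [IsAlgClosed K] (n : ℕ) :
    dim (CT K n) + ((n + 2 : ℕ) : WithBot ℕ∞) ≤ dim (CT K (n + 1)) := by
  obtain ⟨d, hd⟩ := exists_dim_eq_natCast (V := CT K n) ⟨_, diagPair_mem_CT 0 0⟩
  have hdA : ringKrullDim (MvPolynomial (PairIdx n) K ⧸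
    MvPolynomial.vanishingIdeal K (CT K n)) = d := hd
  have : FiniteRingKrullDim (MvPolynomial (PairIdx n) K ⧸
      MvPolynomial.vanishingIdeal K (CT K n)) := by
    rw [finiteRingKrullDim_iff_ne_bot_and_top, hdA]
    exact ⟨nofun, fun h => ENat.natCast_ne_top d (WithBot.coe_injective h)⟩
  let π := Ideal.Quotient.mkₐ K (MvPolynomial.vanishingIdeal K (CT K n))
  have hcomm : ∀ p : StrictIdx n, π (commPoly K n p.1.1 p.1.2) = 0 := by
    refine fun p => Ideal.Quotient.eq_zero_iff_mem.2 fun v hv => ?_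
    rw [CT_eq_setOf_eval_eq_zero] at hv
    rw [MvPolynomial.aeval_eq_eval]
    exact hv p
  have hle := ringKrullDim_quotient_cornerHom_le π (Ideal.Quotient.mkₐ_surjective K _) hcomm
  have hK := ringKrullDim_add_card_le_of_constantCoeff_eq_zero _
    (constantCoeff_cornerHom_commPoly_last π)
  obtain ⟨d', hd'⟩ := exists_dim_eq_natCast (V := CT K (n + 1)) ⟨_, diagPair_mem_CT 0 0⟩
  have h := hK.trans (add_le_add_left hle _)
  rw [hdA, hd', Fintype.card_sum, Fintype.card_fin, Fintype.card_fin] at h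
  rw [hd, hd']
  norm_cast at h ⊢
  omega

/-- Once `CT_n` fails to be a complete intersection, so does every later `CT_m`. -/
lemma not_isCompleteIntersection_CT_of_le {K : Type*} [Field K] [IsAlgClosed K] {n m : ℕ}
    (hnm : n ≤ m) (h : ¬ IsCompleteIntersection (CT K n)) : ¬ IsCompleteIntersection (CT K m) := by
  induction m, hnm using Nat.le_induction with
  | base => exact h
  | succ m _ ih =>
    rw [isCompleteIntersection_CT_iff] at ih ⊢
    intro h'
    have h1 := dim_CT_add_le_dim_CT_succ K m
    have h2 := card_upperIdx_add_le_dim_CT (K := K) (n := m)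
    obtain ⟨d, hd⟩ := exists_dim_eq_natCast (V := CT K m) ⟨_, diagPair_mem_CT 0 0⟩
    rw [hd] at ih h1 h2
    rw [h', card_upperIdx_succ] at h1
    norm_cast at ih h1 h2
    omega

end Monotonicity

/-! ### Regular matrices and their commutants -/

section RegularMatrices

variable {K : Type*} [Field K] {n : ℕ}

open Polynomial in
/-- Over an algebraically closed field, some vector has the minimal polynomial of `M` as its
annihilator: for each root `r`, the vectors killed by `minpoly / (X - r)` form a proper subspace,
and a vector outside all of these will do. -/
lemma exists_vector_minpoly_dvd [IsAlgClosed K] (M : Matrix (Fin n) (Fin n) K) :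
    ∃ v : Fin n → K, ∀ p : K[X], (aeval M p).mulVec v = 0 → minpoly K M ∣ p := by
  classical
  have hint : IsIntegral K M := Matrix.isIntegral M
  have hm0 : minpoly K M ≠ 0 := minpoly.ne_zero hint
  let W : K → Submodule K (Fin n → K) := fun r =>
    LinearMap.ker (aeval M (minpoly K M /ₘ (X - C r))).mulVecLin
  have hdiv : ∀ r ∈ (minpoly K M).roots,
      (X - C r) * (minpoly K M /ₘ (X - C r)) = minpoly K M := fun r hr =>
    mul_divByMonic_eq_iff_isRoot.2 (isRoot_of_mem_roots hr)
  have hW : ⊤ ∉ (minpoly K M).roots.toFinset.image W := by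
    rw [Finset.mem_image]
    rintro ⟨r, hr, h⟩
    rw [Multiset.mem_toFinset] at hr
    have hz : aeval M (minpoly K M /ₘ (X - C r)) = 0 := by
      have h1 := LinearMap.ker_eq_top.1 h
      refine Matrix.toLin'.injective ?_
      rw [map_zero]
      exact h1
    have hdvd := minpoly.dvd K M hz
    have hne : minpoly K M /ₘ (X - C r) ≠ 0 := by
      intro h0
      apply hm0
      rw [← hdiv r hr, h0, mul_zero]
    have h2 := natDegree_le_of_dvd hdvd hne
    have h3 := natDegree_divByMonic (minpoly K M) (monic_X_sub_C r)
    have h4 : (minpoly K M).natDegree ≠ 0 := by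
      intro h0
      rw [eq_one_of_monic_natDegree_zero (minpoly.monic hint) h0] at hr
      simp at hr
    rw [natDegree_X_sub_C] at h3
    omega
  obtain ⟨v, hv⟩ := (Set.ne_univ_iff_exists_notMem _).1
    (Subspace.biUnion_ne_univ_of_top_notMem hW)
  refine ⟨v, fun p hp => ?_⟩
  have hv' : ∀ r ∈ (minpoly K M).roots,
      (aeval M (minpoly K M /ₘ (X - C r))).mulVec v ≠ 0 := by
    intro r hr h
    apply hv
    simp only [Set.mem_iUnion]
    exact ⟨W r, Finset.mem_image.2 ⟨r, Multiset.mem_toFinset.2 hr, rfl⟩, h⟩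
  -- the greatest common divisor `g` of `p` and the minimal polynomial also kills `v`
  set g := EuclideanDomain.gcd p (minpoly K M) with hg
  have hgv : (aeval M g).mulVec v = 0 := by
    rw [hg, EuclideanDomain.gcd_eq_gcd_ab, map_add, map_mul, map_mul, minpoly.aeval, zero_mul,
      add_zero, ((Commute.all p _).map (aeval M)).eq, ← Matrix.mulVec_mulVec, hp,
      Matrix.mulVec_zero]
  obtain ⟨h, hh⟩ := EuclideanDomain.gcd_dvd_right p (minpoly K M)
  have hunit : IsUnit h := by
    by_contra hnu
    have hdeg : h.degree ≠ 0 := fun h0 => hnu (isUnit_iff_degree_eq_zero.2 h0)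
    obtain ⟨r, hr⟩ := IsAlgClosed.exists_root h hdeg
    obtain ⟨h', rfl⟩ := dvd_iff_isRoot.2 hr
    have hroot : r ∈ (minpoly K M).roots := by
      rw [mem_roots hm0, hh, IsRoot, eval_mul, eval_mul]
      simp
    have heq : minpoly K M /ₘ (X - C r) = h' * g := by
      apply mul_left_cancel₀ (X_sub_C_ne_zero r)
      rw [hdiv r hroot, hh]
      ring
    apply hv' r hroot
    rw [heq, map_mul, ← Matrix.mulVec_mulVec, hgv, Matrix.mulVec_zero]
  have hassoc : minpoly K M ∣ g := by
    rw [hh]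
    exact (hunit.mul_right_dvd).2 dvd_rfl
  exact hassoc.trans (EuclideanDomain.gcd_dvd_left p (minpoly K M))

/-- A matrix that commutes with a regular matrix `M` is a polynomial in `M`. -/
lemma IsRegularMatrix.exists_eq_sum_pow [IsAlgClosed K] {M N : Matrix (Fin n) (Fin n) K}
    (hM : IsRegularMatrix M) (hMN : M * N = N * M) :
    ∃ c : Fin n → K, N = ∑ k, c k • M ^ (k : ℕ) := by
  -- `v` is a cyclic vector, and a matrix commuting with `M` is determined by its value at `v`
  obtain ⟨v, hv⟩ := exists_vector_minpoly_dvd M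
  have hli : LinearIndependent K fun k : Fin n => (M ^ (k : ℕ)).mulVec v := by
    rw [Fintype.linearIndependent_iff]
    intro c hc
    let p : Polynomial K := ∑ k : Fin n, Polynomial.monomial (k : ℕ) (c k)
    have hp : (Polynomial.aeval M p).mulVec v = 0 := by
      rw [← hc]
      simp only [p, map_sum, Polynomial.aeval_monomial, Matrix.sum_mulVec]
      refine Finset.sum_congr rfl fun k _ => ?_
      rw [← Algebra.smul_def, Matrix.smul_mulVec]
    have hdeg : p.degree < (minpoly K M).degree := by
      rw [Polynomial.degree_eq_natDegree (minpoly.ne_zero (Matrix.isIntegral M)), hM]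
      refine (Polynomial.degree_sum_le _ _).trans_lt ?_
      rw [Finset.sup_lt_iff (WithBot.bot_lt_coe _)]
      intro k _
      exact (Polynomial.degree_monomial_le _ _).trans_lt (by exact_mod_cast k.2)
    have hp0 := Polynomial.eq_zero_of_dvd_of_degree_lt (hv p hp) hdeg
    intro k
    have hk := congrArg (fun q : Polynomial K => q.coeff k) hp0
    simpa [p, Polynomial.finsetSum_coeff, Polynomial.coeff_monomial, Fin.val_inj] using hk
  have hspan := hli.span_eq_top_of_card_eq_finrank' (by simp)
  obtain ⟨c, hc⟩ := (Submodule.mem_span_range_iff_exists_fun K).1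
    (hspan ▸ Submodule.mem_top : N.mulVec v ∈ _)
  refine ⟨c, ?_⟩
  have hcomm : ∀ k : ℕ, N * M ^ k = M ^ k * N := fun k =>
    (Commute.pow_right (show Commute N M from hMN.symm) k).eq
  have hcomm' : ∀ k : ℕ, (∑ i : Fin n, c i • M ^ (i : ℕ)) * M ^ k =
      M ^ k * ∑ i : Fin n, c i • M ^ (i : ℕ) := by
    intro k
    rw [Finset.sum_mul, Finset.mul_sum]
    refine Finset.sum_congr rfl fun i _ => ?_
    rw [Matrix.smul_mul, Matrix.mul_smul, ← pow_add, ← pow_add, add_comm]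
  have hv0 : (∑ i : Fin n, c i • M ^ (i : ℕ)).mulVec v = N.mulVec v := by
    rw [← hc, Matrix.sum_mulVec]
    exact Finset.sum_congr rfl fun i _ => Matrix.smul_mulVec _ _ _
  refine Matrix.toLin'.injective (LinearMap.ext_on_range hspan fun k => ?_)
  rw [Matrix.toLin'_apply, Matrix.toLin'_apply, Matrix.mulVec_mulVec, Matrix.mulVec_mulVec, hcomm,
    hcomm', ← Matrix.mulVec_mulVec, ← Matrix.mulVec_mulVec, hv0]

/-- An upper triangular matrix with distinct diagonal entries is regular, since every diagonal
entry is an eigenvalue. -/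
lemma isRegularMatrix_of_diag_injective {M : Matrix (Fin n) (Fin n) K}
    (hM : M.BlockTriangular id) (hinj : Function.Injective fun i => M i i) :
    IsRegularMatrix M := by
  classical
  have hint : IsIntegral K M := Matrix.isIntegral M
  have hm0 : minpoly K M ≠ 0 := minpoly.ne_zero hint
  apply le_antisymm
  · have := Polynomial.natDegree_le_of_dvd (Matrix.minpoly_dvd_charpoly M)
      (Matrix.charpoly_monic M).ne_zero
    rwa [Matrix.charpoly_natDegree_eq_dim, Fintype.card_fin] at this
  · have hroot : ∀ i, M i i ∈ (minpoly K M).roots := by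
      intro i
      rw [Polynomial.mem_roots hm0, ← Matrix.minpoly_toLin', ← Module.End.hasEigenvalue_iff_isRoot,
        Module.End.hasEigenvalue_iff_isRoot_charpoly, Matrix.charpoly_toLin',
        Matrix.charpoly_of_isUpperTriangular M hM, Polynomial.IsRoot, Polynomial.eval_prod]
      exact Finset.prod_eq_zero (Finset.mem_univ i) (by simp)
    have h1 : (Finset.univ.image fun i => M i i) ⊆ (minpoly K M).roots.toFinset := by
      intro a ha
      obtain ⟨i, -, rfl⟩ := Finset.mem_image.1 ha
      exact Multiset.mem_toFinset.2 (hroot i)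
    have h2 := Finset.card_le_card h1
    rw [Finset.card_image_of_injective _ hinj, Finset.card_fin] at h2
    exact h2.trans ((Multiset.toFinset_card_le _).trans (Polynomial.card_roots' _))

end RegularMatrices

section GenericPair

variable {K : Type*} [Field K] {n : ℕ}

/-- The parametrization `(X, c) ↦ (X, ∑ c_k X^k)`, as a homomorphism of coordinate rings. -/
noncomputable def powHom (K : Type*) [Field K] (n : ℕ) :
    MvPolynomial (PairIdx n) K →ₐ[K] MvPolynomial (UpperIdx n ⊕ Fin n) K :=
  MvPolynomial.aeval (Sum.elim (fun p => MvPolynomial.X (Sum.inl p)) fun p =>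
    (∑ k : Fin n, (MvPolynomial.X (Sum.inr k) : MvPolynomial (UpperIdx n ⊕ Fin n) K) •
      triMatrix (fun q => MvPolynomial.X (Sum.inl q)) ^ (k : ℕ)) p.1.1 p.1.2)

lemma eval_powHom {v : PairIdx n → K} {c : Fin n → K}
    (h : matY v = ∑ k, c k • matX v ^ (k : ℕ)) (f : MvPolynomial (PairIdx n) K) :
    MvPolynomial.eval (Sum.elim (fun p => v (Sum.inl p)) c) (powHom K n f) =
      MvPolynomial.eval v f := by
  induction f using MvPolynomial.induction_on with
  | C a => simp [powHom]
  | add p q hp hq => simp [hp, hq]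
  | mul_X p i hp =>
    rw [map_mul, map_mul, map_mul, hp]
    congr 1
    rcases i with i | i
    · simp [powHom]
    · have hY : v (Sum.inr i) = matY v i.1.1 i.1.2 :=
        (triMatrix_apply_of_le (fun p => v (Sum.inr p)) i.2).symm
      let ε := MvPolynomial.eval (Sum.elim (fun p => v (Sum.inl p)) c)
      have hX : (triMatrix (fun q => (MvPolynomial.X (Sum.inl q) :
          MvPolynomial (UpperIdx n ⊕ Fin n) K))).map ε = matX v := by
        rw [triMatrix_map]
        have : (ε ∘ fun q => (MvPolynomial.X (Sum.inl q) :
            MvPolynomial (UpperIdx n ⊕ Fin n) K)) = fun q => v (Sum.inl q) := by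
          funext q
          simp [ε]
        rw [this]
        rfl
      have hpow : ∀ k : ℕ, (triMatrix (fun q => (MvPolynomial.X (Sum.inl q) :
          MvPolynomial (UpperIdx n ⊕ Fin n) K)) ^ k).map ε = matX v ^ k := by
        intro k
        rw [← hX]
        exact map_pow ε.mapMatrix _ k
      rw [MvPolynomial.eval_X, hY, h, powHom, MvPolynomial.aeval_X, Sum.elim_inr,
        Matrix.sum_apply, Matrix.sum_apply, map_sum]
      refine Finset.sum_congr rfl fun k _ => ?_
      rw [Matrix.smul_apply, Matrix.smul_apply, ← hpow, smul_eq_mul, smul_eq_mul, map_mul,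
        MvPolynomial.eval_X]
      rfl

variable [IsAlgClosed K]

lemma dim_CTzero_le :
    dim (CTzero K n) ≤ ((Fintype.card (UpperIdx n) + n : ℕ) : WithBot ℕ∞) := by
  rw [CTzero, dim_zariskiClosure]
  -- the pairs of regular matrices lie in the image of `(X, c) ↦ (X, ∑ c_k X^k)`
  have hle : RingHom.ker (powHom K n) ≤ MvPolynomial.vanishingIdeal K
      {v | v ∈ CT K n ∧ IsRegularMatrix (matX v) ∧ IsRegularMatrix (matY v)} := by
    rintro f hf v ⟨hv, hX, -⟩
    obtain ⟨c, hc⟩ := hX.exists_eq_sum_pow hv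
    rw [MvPolynomial.aeval_eq_eval]
    change MvPolynomial.eval v f = 0
    rw [← eval_powHom hc, (RingHom.mem_ker).1 hf, map_zero]
  refine (ringKrullDim_quotient_anti hle).trans (ringKrullDim_le_of_trdeg_le (K := K) ?_)
  refine (trdeg_le_of_injective _ (Ideal.kerLiftAlg_injective (powHom K n))).trans ?_
  simp

lemma card_upperIdx_add_le_dim_CTzero :
    ((Fintype.card (UpperIdx n) + n : ℕ) : WithBot ℕ∞) ≤ dim (CTzero K n) := by
  rw [CTzero, dim_zariskiClosure]
  have : Infinite K := inferInstance
  let e : Fin n ↪ K := Fin.valEmbedding.trans (Infinite.natEmbedding K)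
  obtain ⟨P, hP, hfP, hPv, hdim⟩ := exists_isPrime_card_le_of_common_zero
    (fun p : StrictIdx n => commPoly K n p.1.1 p.1.2) (diagPair e e) (eval_diagPair_commPoly e e)
  -- the product of the `D p` is nonzero exactly where both diagonals have distinct entries
  let D : StrictIdx n → MvPolynomial (PairIdx n) K := fun p =>
    (MvPolynomial.X (Sum.inl ⟨(p.1.1, p.1.1), le_rfl⟩) -
      MvPolynomial.X (Sum.inl ⟨(p.1.2, p.1.2), le_rfl⟩)) *
    (MvPolynomial.X (Sum.inr ⟨(p.1.1, p.1.1), le_rfl⟩) -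
      MvPolynomial.X (Sum.inr ⟨(p.1.2, p.1.2), le_rfl⟩))
  have hD : ∏ p, D p ∉ P := by
    intro h
    have h1 := hPv _ h
    rw [map_prod, Finset.prod_eq_zero_iff] at h1
    obtain ⟨p, -, hp⟩ := h1
    simp [D, diagPair, sub_eq_zero, p.2.ne] at hp
  have hle : MvPolynomial.vanishingIdeal K
      {v | v ∈ CT K n ∧ IsRegularMatrix (matX v) ∧ IsRegularMatrix (matY v)} ≤ P := by
    intro f hf
    -- `f * ∏ p, D p` vanishes on all of `CT_n`
    refine (hP.mem_or_mem (?_ : f * ∏ p, D p ∈ P)).resolve_right hD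
    refine vanishingIdeal_setOf_eval_eq_zero_le hP hfP ?_
    rw [← CT_eq_setOf_eval_eq_zero]
    intro v hv
    rw [MvPolynomial.aeval_eq_eval]
    change MvPolynomial.eval v (f * ∏ p, D p) = 0
    rw [map_mul, map_prod]
    by_cases h0 : ∀ p, MvPolynomial.eval v (D p) ≠ 0
    · have hdiag : ∀ i j : Fin n, i < j →
          matX v i i ≠ matX v j j ∧ matY v i i ≠ matY v j j := by
        intro i j hij
        have := h0 ⟨(i, j), hij⟩
        simpa [D, sub_eq_zero, matX, matY, upperMatrix] using this
      have hf' := hf v ⟨hv,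
        isRegularMatrix_of_diag_injective (triMatrix_blockTriangular fun p => v (Sum.inl p))
          (Function.Injective.of_lt_imp_ne fun i j hij => (hdiag i j hij).1),
        isRegularMatrix_of_diag_injective (triMatrix_blockTriangular fun p => v (Sum.inr p))
          (Function.Injective.of_lt_imp_ne fun i j hij => (hdiag i j hij).2)⟩
      rw [MvPolynomial.aeval_eq_eval] at hf'
      change MvPolynomial.eval v f = 0 at hf'
      rw [hf', zero_mul]
    · push Not at h0
      obtain ⟨p, hp⟩ := h0
      rw [Finset.prod_eq_zero (Finset.mem_univ p) hp, mul_zero]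
  have h := hdim.trans (add_le_add_left (ringKrullDim_quotient_anti hle) _)
  change _ ≤ dim _ + _ at h
  obtain ⟨d, hd⟩ := exists_dim_eq_natCast (V := {v | v ∈ CT K n ∧ IsRegularMatrix (matX v) ∧
    IsRegularMatrix (matY v)}) ⟨diagPair e e, diagPair_mem_CT e e,
      isRegularMatrix_of_diag_injective (triMatrix_blockTriangular
        fun p => diagPair e e (Sum.inl p))
        (by simpa [matX_diagPair] using e.injective),
      isRegularMatrix_of_diag_injective (triMatrix_blockTriangular
        fun p => diagPair e e (Sum.inr p))
        (by simpa [matY_diagPair] using e.injective)⟩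
  have hc := card_upperIdx_eq_add n
  rw [hd, Fintype.card_sum] at h
  rw [hd]
  norm_cast at h ⊢
  omega

end GenericPair

/-! ### The partition into blocks of sizes 1, 5, 6, 5, 1 -/

section Blocks

variable {K : Type*} [Field K]

/-- The index of the block of `{0, …, 17}` containing `i`, for blocks of sizes `1, 5, 6, 5, 1`. -/
def blockOf (i : Fin 18) : ℕ :=
  if (i : ℕ) < 1 then 0 else if (i : ℕ) < 6 then 1 else if (i : ℕ) < 12 then 2
    else if (i : ℕ) < 17 then 3 else 4

lemma blockOf_mono {i j : Fin 18} (h : i ≤ j) : blockOf i ≤ blockOf j := by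
  have h' : (i : ℕ) ≤ j := h
  simp only [blockOf]
  split_ifs <;> omega

lemma index_eq_index_iff {J : Composition 18} (hJ : J.blocks = [1, 5, 6, 5, 1]) (i j : Fin 18) :
    J.index i = J.index j ↔ blockOf i = blockOf j := by
  have hidx : ∀ i, ((J.index i : Fin J.length) : ℕ) = blockOf i := by
    intro i
    have h1 := J.sizeUpTo_index_le i
    have h2 := J.lt_sizeUpTo_index_succ i
    have h3 : ((J.index i : Fin J.length) : ℕ) < 5 := by
      have := (J.index i).2
      simpa [Composition.length, hJ] using this
    simp only [Composition.sizeUpTo, hJ, Fin.val_succ] at h1 h2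
    have hi := i.2
    generalize ((J.index i : Fin J.length) : ℕ) = k at h1 h2 h3
    simp only [blockOf]
    interval_cases k <;> simp at h1 h2 <;> split_ifs <;> omega
  rw [Fin.ext_iff, hidx, hidx]

/-- The positions at least two blocks above the diagonal, where the commutator of two strictly
block upper triangular matrices may be nonzero. -/
abbrev FarIdx : Type := {p : Fin 18 × Fin 18 // blockOf p.1 + 2 ≤ blockOf p.2}

/-- The positions on or above the diagonal inside the diagonal blocks. -/
abbrev BlockIdx : Type := {p : UpperIdx 18 // blockOf p.1.1 = blockOf p.1.2}

/-- The positions strictly above the diagonal inside the diagonal blocks. -/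
abbrev StrictBlockIdx : Type := {p : StrictIdx 18 // blockOf p.1.1 = blockOf p.1.2}

set_option maxRecDepth 10000 in
lemma card_farIdx : Fintype.card FarIdx = 48 := by decide +kernel

set_option maxRecDepth 10000 in
lemma card_blockIdx : Fintype.card BlockIdx = 53 := by decide +kernel

set_option maxRecDepth 10000 in
lemma card_strictBlockIdx : Fintype.card StrictBlockIdx = 35 := by decide +kernel

/-- The equations of the commuting pairs of strictly block upper triangular matrices. -/
noncomputable def blockEq (K : Type*) [Field K] :
    (BlockIdx ⊕ BlockIdx) ⊕ FarIdx → MvPolynomial (PairIdx 18) K :=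
  Sum.elim (Sum.elim (fun p => MvPolynomial.X (Sum.inl p.1))
    (fun p => MvPolynomial.X (Sum.inr p.1))) (fun p => commPoly K 18 p.1.1 p.1.2)

/-- The equations of the commuting pairs of block upper triangular matrices whose block diagonal
parts are scalar. -/
noncomputable def scalarBlockEq (K : Type*) [Field K] :
    ((StrictBlockIdx ⊕ StrictBlockIdx) ⊕ (Fin 17 ⊕ Fin 17)) ⊕ FarIdx →
      MvPolynomial (PairIdx 18) K :=
  Sum.elim (Sum.elim
    (Sum.elim (fun p => MvPolynomial.X (Sum.inl ⟨p.1.1, p.1.2.le⟩))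
      (fun p => MvPolynomial.X (Sum.inr ⟨p.1.1, p.1.2.le⟩)))
    (Sum.elim (fun i => MvPolynomial.X (Sum.inl ⟨(i.succ, i.succ), le_rfl⟩) -
        MvPolynomial.X (Sum.inl ⟨(0, 0), le_rfl⟩))
      (fun i => MvPolynomial.X (Sum.inr ⟨(i.succ, i.succ), le_rfl⟩) -
        MvPolynomial.X (Sum.inr ⟨(0, 0), le_rfl⟩))))
    (fun p => commPoly K 18 p.1.1 p.1.2)

lemma commutator_add_smul_one {n : ℕ} (M N : Matrix (Fin n) (Fin n) K) (x y : K) :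
    (M + x • 1) * (N + y • 1) - (N + y • 1) * (M + x • 1) = M * N - N * M := by
  simp only [add_mul, mul_add, smul_mul_assoc, mul_smul_comm, one_mul, mul_one, smul_add,
    smul_smul, mul_comm y x]
  abel

lemma mem_NTblock {J : Composition 18} (hJ : J.blocks = [1, 5, 6, 5, 1]) {v : PairIdx 18 → K}
    (hX : ∀ p : BlockIdx, v (Sum.inl p.1) = 0) (hY : ∀ p : BlockIdx, v (Sum.inr p.1) = 0)
    (hcomm : ∀ p : FarIdx, (matX v * matY v - matY v * matX v) p.1.1 p.1.2 = 0) :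
    v ∈ NTblock K J := by
  have hX' : ∀ i j, blockOf j ≤ blockOf i → matX v i j = 0 := by
    intro i j hij
    by_cases h : i ≤ j
    · exact (triMatrix_apply_of_le (fun p => v (Sum.inl p)) h).trans
        (hX ⟨⟨(i, j), h⟩, le_antisymm (blockOf_mono h) hij⟩)
    · exact triMatrix_apply_of_lt (fun p => v (Sum.inl p)) (not_le.1 h)
  have hY' : ∀ i j, blockOf j ≤ blockOf i → matY v i j = 0 := by
    intro i j hij
    by_cases h : i ≤ j
    · exact (triMatrix_apply_of_le (fun p => v (Sum.inr p)) h).trans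
        (hY ⟨⟨(i, j), h⟩, le_antisymm (blockOf_mono h) hij⟩)
    · exact triMatrix_apply_of_lt (fun p => v (Sum.inr p)) (not_le.1 h)
  refine ⟨⟨commute_of_strict_blocks hX' hY' fun i j hij => hcomm ⟨(i, j), hij⟩,
    fun i => ⟨hX' i i le_rfl, hY' i i le_rfl⟩⟩, fun i j hij => ?_⟩
  have := ((index_eq_index_iff hJ i j).1 hij).ge
  exact ⟨hX' i j this, hY' i j this⟩

lemma setOf_blockEq_subset {J : Composition 18} (hJ : J.blocks = [1, 5, 6, 5, 1]) :
    {v | ∀ i, MvPolynomial.eval v (blockEq K i) = 0} ⊆ NTblock K J := by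
  intro v hv
  refine mem_NTblock hJ (fun p => ?_) (fun p => ?_) fun p => ?_
  · simpa [blockEq] using hv (Sum.inl (Sum.inl p))
  · simpa [blockEq] using hv (Sum.inl (Sum.inr p))
  · simpa [blockEq, eval_commPoly] using hv (Sum.inr p)

lemma setOf_scalarBlockEq_subset {J : Composition 18} (hJ : J.blocks = [1, 5, 6, 5, 1]) :
    {v | ∀ i, MvPolynomial.eval v (scalarBlockEq K i) = 0} ⊆ scalarOrbit (NTblock K J) := by
  intro v hv
  have hX : ∀ p : StrictBlockIdx, v (Sum.inl ⟨p.1.1, p.1.2.le⟩) = 0 := fun p => by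
    simpa [scalarBlockEq] using hv (Sum.inl (Sum.inl (Sum.inl p)))
  have hY : ∀ p : StrictBlockIdx, v (Sum.inr ⟨p.1.1, p.1.2.le⟩) = 0 := fun p => by
    simpa [scalarBlockEq] using hv (Sum.inl (Sum.inl (Sum.inr p)))
  have hXd : ∀ i, v (Sum.inl ⟨(i, i), le_rfl⟩) = v (Sum.inl ⟨(0, 0), le_rfl⟩) := fun i => by
    induction i using Fin.cases with
    | zero => rfl
    | succ i => simpa [scalarBlockEq, sub_eq_zero] using hv (Sum.inl (Sum.inr (Sum.inl i)))
  have hYd : ∀ i, v (Sum.inr ⟨(i, i), le_rfl⟩) = v (Sum.inr ⟨(0, 0), le_rfl⟩) := fun i => by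
    induction i using Fin.cases with
    | zero => rfl
    | succ i => simpa [scalarBlockEq, sub_eq_zero] using hv (Sum.inl (Sum.inr (Sum.inr i)))
  have hcomm : ∀ p : FarIdx, (matX v * matY v - matY v * matX v) p.1.1 p.1.2 = 0 := fun p => by
    simpa [scalarBlockEq, eval_commPoly] using hv (Sum.inr p)
  set x := v (Sum.inl ⟨(0, 0), le_rfl⟩)
  set y := v (Sum.inr ⟨(0, 0), le_rfl⟩)
  -- subtracting the scalars on the diagonal leaves a strictly block upper triangular pair
  let w : PairIdx 18 → K := Sum.elim
    (fun p => v (Sum.inl p) - if p.1.1 = p.1.2 then x else 0)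
    (fun p => v (Sum.inr p) - if p.1.1 = p.1.2 then y else 0)
  have hwX : matX v = matX w + x • (1 : Matrix (Fin 18) (Fin 18) K) := by
    ext i j
    by_cases h : i ≤ j
    · by_cases h' : i = j <;> simp [matX, upperMatrix, w, h, h']
    · have h' : i ≠ j := fun h' => h h'.le
      simp [matX, upperMatrix, h, h']
  have hwY : matY v = matY w + y • (1 : Matrix (Fin 18) (Fin 18) K) := by
    ext i j
    by_cases h : i ≤ j
    · by_cases h' : i = j <;> simp [matY, upperMatrix, w, h, h']
    · have h' : i ≠ j := fun h' => h h'.le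
      simp [matY, upperMatrix, h, h']
  refine ⟨w, mem_NTblock hJ (fun p => ?_) (fun p => ?_) (fun p => ?_), x, y, hwX, hwY⟩
  · obtain ⟨⟨⟨i, j⟩, hle⟩, hb⟩ := p
    rcases eq_or_lt_of_le hle with h | h
    · change i = j at h
      subst h
      simp [w, hXd]
    · simpa [w, h.ne] using hX ⟨⟨(i, j), h⟩, hb⟩
  · obtain ⟨⟨⟨i, j⟩, hle⟩, hb⟩ := p
    rcases eq_or_lt_of_le hle with h | h
    · change i = j at h
      subst h
      simp [w, hYd]
    · simpa [w, h.ne] using hY ⟨⟨(i, j), h⟩, hb⟩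
  · have h1 : matX v * matY v - matY v * matX v = matX w * matY w - matY w * matX w := by
      rw [hwX, hwY, commutator_add_smul_one]
    rw [← h1]
    exact hcomm p

lemma eval_zero_commPoly (p : FarIdx) :
    MvPolynomial.eval (0 : PairIdx 18 → K) (commPoly K 18 p.1.1 p.1.2) = 0 := by
  have hX : matX (0 : PairIdx 18 → K) = 0 := by
    ext i j
    simp [matX, upperMatrix]
  rw [eval_commPoly, hX]
  simp

lemma scalarOrbit_subset_CT {n : ℕ} {S : Set (PairIdx n → K)} (hS : S ⊆ CT K n) :
    scalarOrbit S ⊆ CT K n := by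
  rintro v ⟨w, hw, x, y, hX, hY⟩
  change matX v * matY v = matY v * matX v
  rw [← sub_eq_zero, hX, hY, commutator_add_smul_one]
  exact sub_eq_zero.2 (hS hw)

variable [IsAlgClosed K]

lemma le_dim_NTblock {J : Composition 18} (hJ : J.blocks = [1, 5, 6, 5, 1]) :
    188 ≤ dim (NTblock K J) := by
  have h0 : ∀ i, MvPolynomial.eval (0 : PairIdx 18 → K) (blockEq K i) = 0 := by
    rintro ((p | p) | p)
    · simp [blockEq]
    · simp [blockEq]
    · exact eval_zero_commPoly p
  have h := card_le_dim_add_card (blockEq K) 0 h0 (setOf_blockEq_subset hJ)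
  obtain ⟨d, hd⟩ := exists_dim_eq_natCast ⟨_, setOf_blockEq_subset (K := K) hJ h0⟩
  simp only [Fintype.card_sum, card_farIdx, card_blockIdx, card_upperIdx_eighteen, hd] at h
  rw [hd]
  norm_cast at h ⊢
  omega

lemma le_dim_scalarOrbit {J : Composition 18} (hJ : J.blocks = [1, 5, 6, 5, 1]) :
    190 ≤ dim (scalarOrbit (NTblock K J)) := by
  have h0 : ∀ i, MvPolynomial.eval (0 : PairIdx 18 → K) (scalarBlockEq K i) = 0 := by
    rintro (((p | p) | (p | p)) | p)
    · simp [scalarBlockEq]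
    · simp [scalarBlockEq]
    · simp [scalarBlockEq]
    · simp [scalarBlockEq]
    · exact eval_zero_commPoly p
  have h := card_le_dim_add_card (scalarBlockEq K) 0 h0 (setOf_scalarBlockEq_subset hJ)
  obtain ⟨d, hd⟩ := exists_dim_eq_natCast ⟨_, setOf_scalarBlockEq_subset (K := K) hJ h0⟩
  simp only [Fintype.card_sum, Fintype.card_fin, card_farIdx, card_strictBlockIdx,
    card_upperIdx_eighteen, hd] at h
  rw [hd]
  norm_cast at h ⊢
  omega

lemma not_isCompleteIntersection_CT_eighteen : ¬ IsCompleteIntersection (CT K 18) := by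
  let J : Composition 18 := ⟨[1, 5, 6, 5, 1], by simp, rfl⟩
  have h1 : 190 ≤ dim (CT K 18) := (le_dim_scalarOrbit (K := K) (J := J) rfl).trans
    (dim_mono (scalarOrbit_subset_CT fun v hv => hv.1.1))
  rw [isCompleteIntersection_CT_iff, card_upperIdx_eighteen]
  intro h2
  rw [h2] at h1
  norm_cast at h1

end Blocks

end CommTri

theorem mainTheorem2 {K : Type*} [Field K] [IsAlgClosed K]
    (J : Composition 18) (hJ : J.blocks = [1, 5, 6, 5, 1]) :
    188 ≤ CommTri.dim (CommTri.NTblock K J) ∧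
    190 ≤ CommTri.dim (CommTri.scalarOrbit (CommTri.NTblock K J)) ∧
    CommTri.dim (CommTri.CTzero K 18) = 189 ∧
    ¬ CommTri.IsCompleteIntersection (CommTri.CT K 18) ∧
    ¬ CommTri.IsIdealCompleteIntersection (CommTri.CT K 18) ∧
    ∃ m : ℕ, m < 18 ∧
      ∀ n : ℕ, 1 ≤ n → (¬ CommTri.IsCompleteIntersection (CommTri.CT K n) ↔ m < n) := by
  classical
  have h18 := CommTri.not_isCompleteIntersection_CT_eighteen (K := K)
  refine ⟨CommTri.le_dim_NTblock hJ, CommTri.le_dim_scalarOrbit hJ, ?_, h18, ?_, ?_⟩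
  · refine le_antisymm (CommTri.dim_CTzero_le.trans_eq ?_)
      (le_trans (le_of_eq ?_) CommTri.card_upperIdx_add_le_dim_CTzero) <;>
    · rw [CommTri.card_upperIdx_eighteen]
      rfl
  · refine fun h => h18 (CommTri.isCompleteIntersection_of_isIdealCompleteIntersection ?_ h)
    refine Set.Subset.antisymm ?_ (MvPolynomial.zeroLocus_vanishingIdeal_le _)
    intro v hv
    rw [CommTri.CT_eq_setOf_eval_eq_zero]
    intro p
    refine hv _ fun w hw => ?_
    rw [CommTri.CT_eq_setOf_eval_eq_zero] at hw
    exact hw p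
  · have hex : ∃ n, 1 ≤ n ∧ ¬ CommTri.IsCompleteIntersection (CommTri.CT K n) :=
      ⟨18, by norm_num, h18⟩
    obtain ⟨h1, h2⟩ := Nat.find_spec hex
    have hle : Nat.find hex ≤ 18 := Nat.find_min' hex ⟨by norm_num, h18⟩
    refine ⟨Nat.find hex - 1, by omega, fun n hn => ⟨fun h => ?_, fun h => ?_⟩⟩
    · have := Nat.find_min' hex ⟨hn, h⟩
      omega
    · exact CommTri.not_isCompleteIntersection_CT_of_le (by omega) h2
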